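/- **Setting.** Let $A$ be a non-empty countable alphabet, enumerated (so identified with a subset of $\{1,2,\dots\}$), let $A^{-\mathbb N}$ be the set of pasts $\underline a=\dots a_{-2}a_{-1}$, and let $P$ be a kernel on $A$, i.e. $P(a|\underline a)\ge 0$ and $\sum_{a}P(a|\underline a)=1$ for every past. For a finite string $v$ and strings $b,\underline z$, write $P(a|v\,b\,\underline z)$ for the value at the past whose most recent symbols are $v$, preceded in time by $b$, preceded by $\underline z$. Put $\alpha(a)=\inf_{\underline z}P(a|\underline z)$ and $\alpha_{-1}=\sum_a\alpha(a)$, and assume that $P$ is weakly non-null: $\alpha_{-1}>0$. Let $\mathbf U=(U_i)_{i\in\mathbb Z}$ be i.i.d. uniform on $[0,1)$. A *context tree* is a set $\tau$ of finite or infinite strings such that each past $\underline a$ has exactly one suffix $c_\tau(\underline a)$ in $\tau$; a *skeleton* is a context tree that is the smallest one containing its infinite elements (the root tree $\tau=\emptyset$, whose only element is the empty string, is also a skeleton). For a finite $v\in\tau$ and $k\ge0$ put $$\alpha_k^v=\inf_{b\in A^k}\sum_{a\in A}\inf_{\underline z}P(a|v\,b\,\underline z),\qquad \alpha_k=\inf_{v\in\tau,\,|v|<\infty}\alpha_k^v$$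 (an infimum in $[0,1]$). $P$ is *uniformly locally continuous* with respect to $\tau$, written $P\in ULC(\tau)$, if $\alpha_k\to1$. Let $Y_i=a$ if $\sum_{b<a}\alpha(b)\le U_i<\sum_{b\le a}\alpha(b)$ and $Y_i=\star$ if $U_i\ge\alpha_{-1}$. Let $c_\tau^n\in\mathbb N\cup\{\infty\}$ be the supremum, over all ways of replacing the stars among $(Y_i)_{i\le n}$ by symbols, of the length of the context of the resulting past $\dots Y_{n-1}Y_n$. Let $$\bar\theta[0]=\sup\{i\le0:\ Y_j\in A\ \text{or}\ c_\tau^{j-1}\le j-i,\ \text{ for each } j=i,\dots,0\}$$ ($-\infty$ if the set is empty). The probabilistic skeleton of $P$ is *good* if $\mathbb E|\bar\theta[0]|<\infty$. An *update function* for $P$ is a map $F:A^{-\mathbb N}\times[0,1)\to A$, measurable in the second variable, with $\mathbb P(F(\underline a,U_0)=a)=P(a|\underline a)$ for all $a,\underline a$. Starting from the past $\underline a$ of time $j$ and using $U_j,U_{j+1},\dots$, it constructs successively symbols at the times $j,j+1,\dots$; let $\theta[m,n]$ be the largest $j\le m$ such that the symbols so constructed at the times $m,\dots,n$ do not depend on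 $\underline a$ ($-\infty$ if there is none), and $\theta[0]=\theta[0,0]$. The coupling from the past with update function $F$ is *feasible* if $\theta[m,n]$ is a.s. finite for all integers $m\le n$. A random variable $W$ has *summable tail* if $\sum_n\mathbb P(|W|\ge n)<\infty$, and *exponential tail* if $\mathbb P(|W|\ge n)\le Dd^n$ for all $n$, with constants $D>0$, $0<d<1$; a sequence $c_n\ge0$ decays exponentially fast if $c_n\le Dd^n$ for all $n$, with such constants. **Statement.** Let $\tau$ be a skeleton with $P\in ULC(\tau)$, whose probabilistic skeleton is good. Put $A_0=\alpha_{-1}$ and $$A_m=1-\mathbb E(|\bar\theta[0]|+1)\,(1-\alpha_m),\qquad m\ge1.$$ Then there is an update function $F$ for $P$ such that (i) if $\sum_{k\ge1}\prod_{j=0}^{k-1}A_j=+\infty$, then $\theta[0]$ is a.s. finite; (ii) if $\sum_{k\ge0}(1-A_k)<+\infty$, then $\theta[0]$ has summable tail; (iii) if $\bar\theta[0]$ has exponential tail and $(1-A_k)_{k\ge0}$ decays exponentially fast to zero, then $\theta[0]$ has exponential tail; and in each of these three regimes the coupling from the past with update function $F$ is feasible. For $\tau=\emptyset$ this is the setting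 of Comets, Fernández and Ferrari: $\emptyset$ is a skeleton, the corresponding probabilistic skeleton is good, $P\in ULC(\emptyset)$ if and only if $P$ is continuous, i.e. $\omega_k:=\inf_{b\in A^k}\sum_{a}\inf_{\underline z}P(a|b\,\underline z)\to1$, and $A_k=\omega_k$ for every $k\ge0$. -/

import Mathlib

open MeasureTheory ProbabilityTheory Filter Topology
open scoped ENNReal

noncomputable section

namespace CFTP

universe u v

/-! ### Kernels

A past `… a₋₂ a₋₁` is a stream whose entry number `k` is `a₋ₖ₋₁` (most recent symbol first), and a
finite string of past symbols is a list, also with the most recent symbol first.  So `l ++ₛ z` is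
the past whose most recent symbols are those of `l`, and whose older part is `z`. -/

/-- A transition probability kernel on the alphabet `A`; `P a x` is `P(a | x)`. -/
structure TransitionKernel (A : Type u) where
  toFun : A → Stream' A → ℝ
  nonneg : ∀ a x, 0 ≤ toFun a x
  hasSum : ∀ x, HasSum (fun a => toFun a x) 1

instance {A : Type u} : CoeFun (TransitionKernel A) (fun _ => A → Stream' A → ℝ) :=
  ⟨TransitionKernel.toFun⟩

variable {A : Type u}

/-- `inf_z P(a | l z)`, the infimum over all pasts whose most recent symbols are `l`. -/
def lowerProb (P : TransitionKernel A) (l : List A) (a : A) : ℝ :=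
  ⨅ z : Stream' A, P a (l ++ₛ z)

/-- `α(a) = inf_z P(a | z)`. -/
def alphaSymb (P : TransitionKernel A) (a : A) : ℝ := lowerProb P [] a

/-- `α₋₁ = ∑ₐ α(a)`. -/
def alphaNeg (P : TransitionKernel A) : ℝ := ∑' a, alphaSymb P a

/-- `P` is weakly non-null. -/
def WeaklyNonNull (P : TransitionKernel A) : Prop := 0 < alphaNeg P

/-- `ω_k`, the infimum over all strings `b` of length `k` of `∑ₐ inf_z P(a | b z)`. -/
def omegaRate (P : TransitionKernel A) (k : ℕ) : ℝ :=
  ⨅ b : List.Vector A k, ∑' a, lowerProb P b.toList a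

/-- `P` is (uniformly) continuous. -/
def IsContinuousKernel (P : TransitionKernel A) : Prop :=
  Tendsto (omegaRate P) atTop (𝓝 1)

/-! ### Context trees and skeletons -/

/-- Finite or infinite strings of past symbols. -/
abbrev PastString (A : Type u) : Type u := List A ⊕ Stream' A

/-- The length of a finite or infinite string. -/
def PastString.len : PastString A → ℕ∞
  | Sum.inl l => (l.length : ℕ∞)
  | Sum.inr _ => ⊤

/-- The string `w` is made of the most recent symbols of the past `x`. -/
def PastString.IsSuffixOf : PastString A → Stream' A → Prop
  | Sum.inl l, x => x.take l.length = l
  | Sum.inr w, x => w = x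

/-- A context tree: a set of strings that partitions the set of all pasts, i.e. each past has
exactly one suffix in the set.  (In particular no element is a proper suffix of another one.) -/
def IsContextTree (τ : Set (PastString A)) : Prop :=
  ∀ x : Stream' A, ∃! w : PastString A, w ∈ τ ∧ w.IsSuffixOf x

/-- `c_τ(x)`, the element of the context tree `τ` that is a suffix of `x`. -/
def context (τ : Set (PastString A)) (x : Stream' A) : PastString A :=
  Classical.epsilon fun w => w ∈ τ ∧ w.IsSuffixOf x

theorem context_spec {τ : Set (PastString A)} (h : IsContextTree τ) (x : Stream' A) :
    context τ x ∈ τ ∧ (context τ x).IsSuffixOf x :=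
  Classical.epsilon_spec (h x).exists

/-- The tree `τ` is contained in the tree `τ'`: no past has a longer context in `τ` than in `τ'`.
For two context trees this says that each element of `τ` is a suffix of an element of `τ'`. -/
def TreeLE (τ τ' : Set (PastString A)) : Prop :=
  ∀ x : Stream' A, (context τ x).len ≤ (context τ' x).len

/-- The tree reduced to its root: its only element is the empty string. -/
def rootTree (A : Type u) : Set (PastString A) := {Sum.inl []}

/-- A skeleton: a context tree that is the root, or that is the smallest one among the context
trees that contain all its infinite elements. -/
def IsSkeleton (τ : Set (PastString A)) : Prop :=
  IsContextTree τ ∧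
    (τ = rootTree A ∨
      ∀ τ' : Set (PastString A), IsContextTree τ' →
        (∀ x : Stream' A, Sum.inr x ∈ τ → Sum.inr x ∈ τ') → TreeLE τ τ')

/-! ### Uniform local continuity -/

/-- `α_k^v`, the infimum over all strings `b` of length `k` of `∑ₐ inf_z P(a | v b z)`: the most
recent symbols are those of `v`, then come (going back in time) those of `b`. -/
def alphaCtx (P : TransitionKernel A) (v : List A) (k : ℕ) : ℝ :=
  ⨅ b : List.Vector A k, ∑' a, lowerProb P (v ++ b.toList) a

/-- `α_k`, the infimum of `α_k^v` over the finite contexts `v` of `τ`.  The infimum is taken in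
`[0,1]`, where all `α_k^v` lie: it is `1` if `τ` has no finite context. -/
def alphaUnif (P : TransitionKernel A) (τ : Set (PastString A)) (k : ℕ) : ℝ :=
  sInf (insert 1 {r : ℝ | ∃ v : List A, Sum.inl v ∈ τ ∧ r = alphaCtx P v k})

/-- `P` is uniformly locally continuous with respect to `τ`. -/
def IsULC (P : TransitionKernel A) (τ : Set (PastString A)) : Prop :=
  Tendsto (alphaUnif P τ) atTop (𝓝 1)

/-! ### Good coalescence times -/

section Good

variable [Encodable A]

/-- `u` lies in the interval of the symbol `a`: these are consecutive intervals of lengths `α(a)`,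
starting from `0`, in the order of the enumeration of the alphabet. -/
def InSymbInterval (P : TransitionKernel A) (u : ℝ) (a : A) : Prop :=
  (∑' b, if Encodable.encode b < Encodable.encode a then alphaSymb P b else 0) ≤ u ∧
    u < ∑' b, if Encodable.encode b ≤ Encodable.encode a then alphaSymb P b else 0

open Classical in
/-- The value of `Y_i` when `U_i = u`: a symbol if `u < α₋₁`, and otherwise `⋆`, here `none`. -/
def symbY (P : TransitionKernel A) (u : ℝ) : Option A :=
  if h : ∃ a, InSymbInterval P u a then some h.choose else none

/-- The past `Y_{-∞}^n(a)` seen after time `n`, where the stars of `Y` are filled with `a`. -/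
def filledPast (P : TransitionKernel A) (u : ℤ → ℝ) (a : ℤ → A) (n : ℤ) : Stream' A :=
  fun k => (symbY P (u (n - k))).getD (a (n - k))

/-- `c_τ^n`, the supremum over `a` of the length of the context of `Y_{-∞}^n(a)`. -/
def maxContextLen (P : TransitionKernel A) (τ : Set (PastString A)) (u : ℤ → ℝ) (n : ℤ) : ℕ∞ :=
  ⨆ a : ℤ → A, (context τ (filledPast P u a n)).len

/-- The good coalescence times for time `m`: the times `i ≤ m` such that, for each `j` in `i,…,m`,
either `Y_j` is a symbol or the context of the past of `j` can be read off `Y_i,…,Y_{j-1}`. -/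
def goodTimes (P : TransitionKernel A) (τ : Set (PastString A)) (u : ℤ → ℝ) (m : ℤ) : Set ℤ :=
  {i | i ≤ m ∧ ∀ j, i ≤ j → j ≤ m →
    symbY P (u j) ≠ none ∨ maxContextLen P τ u (j - 1) ≤ ((j - i).toNat : ℕ∞)}

/-- `θ̄[m]`, the supremum of the good coalescence times for time `m` (`-∞` if there is none). -/
def goodTheta (P : TransitionKernel A) (τ : Set (PastString A)) (u : ℤ → ℝ) (m : ℤ) : EReal :=
  sSup ((fun i : ℤ => ((i : ℝ) : EReal)) '' goodTimes P τ u m)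

end Good

/-! ### Update functions and coalescence times -/

/-- `F` is an update function for `P`: for each past `x` and `U` uniform on `[0,1)`, the symbol
`F(x, U)` has the law `P(· | x)`. -/
def IsUpdateFunction (P : TransitionKernel A) (F : Stream' A → ℝ → A) : Prop :=
  ∀ x a, MeasurableSet {r : ℝ | F x r = a} ∧
    volume.restrict (Set.Ico (0 : ℝ) 1) {r : ℝ | F x r = a} = ENNReal.ofReal (P a x)

/-- The past obtained from `x`, the past of time `k`, when `t` symbols have been added to it, at
the times `k, …, k + t - 1`, with the update function `F`. -/
def runFrom (F : Stream' A → ℝ → A) (u : ℤ → ℝ) (k : ℤ) (x : Stream' A) : ℕ → Stream' A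
  | 0 => x
  | t + 1 => Stream'.cons (F (runFrom F u k x t) (u (k + t))) (runFrom F u k x t)

/-- `F_{[k,l]}(x, u_k^l)` for `k ≤ l`: the symbol constructed at time `l` from the past `x` of
time `k`. -/
def iterF (F : Stream' A → ℝ → A) (u : ℤ → ℝ) (k l : ℤ) (x : Stream' A) : A :=
  F (runFrom F u k x (l - k).toNat) (u l)

/-- `θ[m,n]`, the last time `j ≤ m` from which the symbols constructed in the window `m,…,n` do not
depend on the past of time `j` (`-∞` if there is none). -/
def theta (F : Stream' A → ℝ → A) (u : ℤ → ℝ) (m n : ℤ) : EReal :=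
  sSup ((fun j : ℤ => ((j : ℝ) : EReal)) ''
    {j : ℤ | j ≤ m ∧ ∀ i, m ≤ i → i ≤ n → ∀ x y : Stream' A, iterF F u j i x = iterF F u j i y})

/-! ### Tails and the sequence of the result -/

section Prob

variable {Ω : Type v} [MeasurableSpace Ω]

/-- `∑ₙ ℙ(|W| ≥ n) < ∞`. -/
def HasSummableTail (μ : Measure Ω) (W : Ω → EReal) : Prop :=
  ∑' n : ℕ, μ {ω | (n : ℝ≥0∞) ≤ (W ω).abs} ≠ ∞

/-- `ℙ(|W| ≥ n)` decays exponentially fast. -/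
def HasExpTail (μ : Measure Ω) (W : Ω → EReal) : Prop :=
  ∃ D d : ℝ, 0 < D ∧ 0 < d ∧ d < 1 ∧
    ∀ n : ℕ, μ {ω | (n : ℝ≥0∞) ≤ (W ω).abs} ≤ ENNReal.ofReal (D * d ^ n)

/-- The sequence `c` decays exponentially fast to zero. -/
def DecaysExp (c : ℕ → ℝ) : Prop :=
  ∃ D d : ℝ, 0 < D ∧ 0 < d ∧ d < 1 ∧ ∀ n : ℕ, c n ≤ D * d ^ n

/-- `U` is an i.i.d. sequence of random variables that are uniform on `[0,1)`. -/
def IsIIDUniform (μ : Measure Ω) (U : ℤ → Ω → ℝ) : Prop :=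
  (∀ i, Measurable (U i)) ∧ iIndepFun U μ ∧
    ∀ i, μ.map (U i) = volume.restrict (Set.Ico (0 : ℝ) 1)

/-- The coupling from the past with update function `F` is feasible: the coalescence time of each
finite window is almost surely finite. -/
def IsFeasible (μ : Measure Ω) (U : ℤ → Ω → ℝ) (F : Stream' A → ℝ → A) : Prop :=
  ∀ m n : ℤ, m ≤ n → ∀ᵐ ω ∂μ, theta F (fun i => U i ω) m n ≠ ⊥

variable [Encodable A]

/-- The probabilistic skeleton of `P` with respect to `τ` is good: `𝔼|θ̄[0]| < ∞`. -/
def IsGood (μ : Measure Ω) (U : ℤ → Ω → ℝ) (P : TransitionKernel A) (τ : Set (PastString A)) :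
    Prop :=
  ∫⁻ ω, (goodTheta P τ (fun i => U i ω) 0).abs ∂μ ≠ ∞

/-- `A₀ = α₋₁` and `A_k = 1 - 𝔼(|θ̄[0]| + 1) (1 - α_k)` for `k ≥ 1`. -/
def rateA (μ : Measure Ω) (U : ℤ → Ω → ℝ) (P : TransitionKernel A) (τ : Set (PastString A))
    (k : ℕ) : ℝ :=
  if k = 0 then alphaNeg P
  else 1 - (∫⁻ ω, ((goodTheta P τ (fun i => U i ω) 0).abs + 1) ∂μ).toReal * (1 - alphaUnif P τ k)

end Prob

end CFTP

end

open CFTP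

/-!
The update function fills the unit interval in layers.  The layer `0` gives each symbol `a` its mass
`α(a)`, so that it reproduces the symbols `Y`; the layers up to `k + 1` give it the mass
`inf_z P(a | w z)`, where `w` is the context of the past followed by `k` more symbols.  Hence a number
below `α_k` is translated into a symbol by reading only the context and `k` symbols behind it
(`update_congr`).

Behind a target time `n`, the good coalescence time `θ̄[n]` cuts off a block inside which each
context can be read, whatever the stars are.  The only symbols still needed are those behind the
contexts, and their number is at most the rank of the block, the largest `k` that is needed at a
time of the block.  Cutting off good blocks repeatedly, as soon as block `k` has rank at most `r - k`
for all `k ≤ r`, no symbol behind block `r` is needed (each block has length at least one), and the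
left end of block `r` is a coalescence time (`le_theta`).  That `θ̄[n] ≥ i` is decided by the times
`i, …, n`, so the sequence regenerates at the end of a block
(`IsBlockRule.lintegral_mul_blockShift`), and the pairs (length, rank) are i.i.d.  By Wald's identity
a rank exceeds `m` with probability at most `𝔼(|θ̄[0]| + 1) (1 - α_m) = 1 - A_m`
(`measure_lt_blockRank_le`).

It remains to study the first `r` that closes the blocks.  Let `p_m` be the probability of a rank at
most `m`, and `u_n` the probability that no `r < n` closes.  Splitting according to the last `r < n`
that closes gives the renewal identity `∑_{w ≤ n} p₀ ⋯ p_{w-1} u_{n-w} = 1`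
(`IsBlockRule.isRenewal`).  As `u` is nonincreasing, `u_n ∑_{w ≤ n} p₀ ⋯ p_{w-1} ≤ 1`, which settles
the first regime; if `∏ p_j > 0`, then `∑ u_n` converges, and so does the expectation
`𝔼(|θ̄[0]| + 1) ∑ u_n` of the total length of the blocks up to the first closing one; and if `1 - p_j`
decays exponentially fast, then so does `u_n`, because the generating function of
`p₀ ⋯ p_{w-1} (1 - p_w)` is less than `1` slightly to the right of `1`.  Feasibility follows by
stationarity: each single time coalesces, and coalescence persists when one starts earlier.
-/

noncomputable section

namespace CFTP

universe u v

/-! ### Partition of the unit interval into cells -/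

section Cells

variable {A : Type u}

theorem summable_ite_of_summable {δ : A → ℝ} (h0 : ∀ a, 0 ≤ δ a) (hs : Summable δ)
    (p : A → Prop) [DecidablePred p] : Summable fun b => if p b then δ b else 0 :=
  Summable.of_nonneg_of_le (fun b => by split_ifs <;> simp [h0])
    (fun b => by split_ifs <;> simp [h0]) hs

/-- A nondecreasing sequence of summable weights on the alphabet: its increments are the masses
that are allotted, one layer after the other, to the symbols. -/
structure IsLayering (l : ℕ → A → ℝ) : Prop where
  nonneg : ∀ a, 0 ≤ l 0 a
  mono : ∀ k a, l k a ≤ l (k + 1) a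
  summable : ∀ k, Summable (l k)

/-- The mass that layer `k` adds to each symbol. -/
def layerInc (l : ℕ → A → ℝ) : ℕ → A → ℝ
  | 0, a => l 0 a
  | k + 1, a => l (k + 1) a - l k a

/-- The total mass of the layers before layer `k`. -/
def layerStart (l : ℕ → A → ℝ) : ℕ → ℝ
  | 0 => 0
  | k + 1 => ∑' a, l k a

theorem sum_layerInc (l : ℕ → A → ℝ) (n : ℕ) (a : A) :
    ∑ k ∈ Finset.range (n + 1), layerInc l k a = l n a := by
  induction n with
  | zero => simp [layerInc]
  | succ n ih => rw [Finset.sum_range_succ, ih]; simp [layerInc]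

namespace IsLayering

variable {l : ℕ → A → ℝ}

theorem inc_nonneg (h : IsLayering l) : ∀ k a, 0 ≤ layerInc l k a
  | 0, a => h.nonneg a
  | k + 1, a => sub_nonneg.2 (h.mono k a)

theorem inc_summable (h : IsLayering l) : ∀ k, Summable (layerInc l k)
  | 0 => h.summable 0
  | k + 1 => (h.summable (k + 1)).sub (h.summable k)

theorem start_succ (h : IsLayering l) :
    ∀ k, layerStart l (k + 1) = layerStart l k + ∑' a, layerInc l k a
  | 0 => by simp [layerStart, layerInc]
  | k + 1 => by
    simp only [layerStart, layerInc]
    rw [(h.summable (k + 1)).tsum_sub (h.summable k)]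
    ring

theorem start_mono (h : IsLayering l) : Monotone (layerStart l) :=
  monotone_nat_of_le_succ fun k => by
    rw [h.start_succ]
    exact le_add_of_nonneg_right (tsum_nonneg (h.inc_nonneg k))

end IsLayering

variable [Encodable A]

/-- The total mass under `δ` of the symbols whose code is less than `n`. -/
def cumMass (δ : A → ℝ) (n : ℕ) : ℝ :=
  ∑' b, if Encodable.encode b < n then δ b else 0

theorem cumMass_zero (δ : A → ℝ) : cumMass δ 0 = 0 := by simp [cumMass]

theorem cumMass_mono {δ : A → ℝ} (h0 : ∀ a, 0 ≤ δ a) (hs : Summable δ) : Monotone (cumMass δ) := by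
  intro m n hmn
  refine Summable.tsum_le_tsum (fun b => ?_) (summable_ite_of_summable h0 hs _)
    (summable_ite_of_summable h0 hs _)
  have := h0 b
  split_ifs <;> first | omega | simp

theorem cumMass_le_tsum {δ : A → ℝ} (h0 : ∀ a, 0 ≤ δ a) (hs : Summable δ) (n : ℕ) :
    cumMass δ n ≤ ∑' b, δ b := by
  refine Summable.tsum_le_tsum (fun b => ?_) (summable_ite_of_summable h0 hs _) hs
  have := h0 b
  split_ifs <;> simp [this]

theorem cumMass_encode_succ {δ : A → ℝ} (h0 : ∀ a, 0 ≤ δ a) (hs : Summable δ) (a : A) :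
    cumMass δ (Encodable.encode a + 1) = cumMass δ (Encodable.encode a) + δ a := by
  classical
  have h1 : δ a = ∑' b, if b = a then δ b else 0 := by
    rw [tsum_ite_eq]
  have h2 : Summable fun b => if b = a then δ b else 0 := summable_ite_of_summable h0 hs _
  rw [h1, cumMass, cumMass, ← Summable.tsum_add (summable_ite_of_summable h0 hs _) h2]
  refine tsum_congr fun b => ?_
  by_cases hb : b = a
  · simp [hb]
  · have : Encodable.encode b ≠ Encodable.encode a := fun h => hb (Encodable.encode_injective h)
    have h2 : Encodable.encode b < Encodable.encode a + 1 ↔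
      Encodable.encode b < Encodable.encode a := by omega
    simp [hb, h2]

theorem exists_encode_eq_of_cumMass_ne {δ : A → ℝ} {n : ℕ} (h : cumMass δ n ≠ cumMass δ (n + 1)) :
    ∃ a : A, Encodable.encode a = n := by
  by_contra! hc
  refine h (tsum_congr fun b => ?_)
  have := hc b
  have h2 : Encodable.encode b < n + 1 ↔ Encodable.encode b < n := by omega
  simp [h2]

theorem tendsto_cumMass {δ : A → ℝ} (h0 : ∀ a, 0 ≤ δ a) (hs : Summable δ) :
    Tendsto (cumMass δ) atTop (𝓝 (∑' b, δ b)) := by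
  refine tendsto_tsum_of_dominated_convergence hs (fun b => ?_) (Eventually.of_forall fun n b => ?_)
  · refine tendsto_const_nhds.congr' ?_
    filter_upwards [eventually_gt_atTop (Encodable.encode b)] with n hn
    simp [hn]
  · have := h0 b
    split_ifs <;> simp [abs_of_nonneg this, this]

theorem exists_mem_Ico_cumMass {δ : A → ℝ} (h0 : ∀ a, 0 ≤ δ a) (hs : Summable δ) {t : ℝ}
    (ht : 0 ≤ t) (ht' : t < ∑' b, δ b) :
    ∃ a : A, t ∈ Set.Ico (cumMass δ (Encodable.encode a)) (cumMass δ (Encodable.encode a + 1)) := by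
  classical
  have hex : ∃ n, t < cumMass δ n := ((tendsto_cumMass h0 hs).eventually_const_lt ht').exists
  have hn := Nat.find_spec hex
  have hpos : Nat.find hex ≠ 0 := by
    intro h
    rw [h, cumMass_zero] at hn
    linarith
  obtain ⟨m, hm⟩ := Nat.exists_eq_succ_of_ne_zero hpos
  have hlow : cumMass δ m ≤ t := not_lt.1 (Nat.find_min hex (by omega))
  rw [hm] at hn
  obtain ⟨a, ha⟩ := exists_encode_eq_of_cumMass_ne (δ := δ) (n := m) (hlow.trans_lt hn).ne
  exact ⟨a, by rw [ha]; exact ⟨hlow, hn⟩⟩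

theorem eq_of_mem_Ico_cumMass {δ : A → ℝ} (h0 : ∀ a, 0 ≤ δ a) (hs : Summable δ) {t : ℝ} {a b : A}
    (ha : t ∈ Set.Ico (cumMass δ (Encodable.encode a)) (cumMass δ (Encodable.encode a + 1)))
    (hb : t ∈ Set.Ico (cumMass δ (Encodable.encode b)) (cumMass δ (Encodable.encode b + 1))) :
    a = b := by
  refine Encodable.encode_injective (le_antisymm ?_ ?_)
  · by_contra! h
    have := cumMass_mono h0 hs (Nat.succ_le_of_lt h)
    exact absurd (ha.1.trans_lt hb.2) (not_lt.2 this)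
  · by_contra! h
    have := cumMass_mono h0 hs (Nat.succ_le_of_lt h)
    exact absurd (hb.1.trans_lt ha.2) (not_lt.2 this)

/-- The interval of the symbol `a` in layer `k`: the layers follow one another from `0` upwards,
and inside a layer the symbols come in the order of the enumeration of the alphabet. -/
def cell (l : ℕ → A → ℝ) (k : ℕ) (a : A) : Set ℝ :=
  Set.Ico (layerStart l k + cumMass (layerInc l k) (Encodable.encode a))
    (layerStart l k + cumMass (layerInc l k) (Encodable.encode a + 1))

theorem mem_cell_iff {l : ℕ → A → ℝ} {k : ℕ} {a : A} {t : ℝ} :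
    t ∈ cell l k a ↔ t - layerStart l k ∈ Set.Ico (cumMass (layerInc l k) (Encodable.encode a))
      (cumMass (layerInc l k) (Encodable.encode a + 1)) := by
  simp only [cell, Set.mem_Ico]
  constructor <;> rintro ⟨h1, h2⟩ <;> constructor <;> linarith

namespace IsLayering

variable {l : ℕ → A → ℝ}

theorem cell_subset (h : IsLayering l) (k : ℕ) (a : A) :
    cell l k a ⊆ Set.Ico (layerStart l k) (layerStart l (k + 1)) := by
  intro t ht
  rw [mem_cell_iff] at ht
  have h1 := cumMass_le_tsum (h.inc_nonneg k) (h.inc_summable k) (Encodable.encode a + 1)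
  have h2 := cumMass_mono (h.inc_nonneg k) (h.inc_summable k) (Nat.zero_le (Encodable.encode a))
  rw [cumMass_zero] at h2
  have h3 := h.start_succ k
  constructor <;> linarith [ht.1, ht.2]

theorem cell_unique (h : IsLayering l) {k k' : ℕ} {a a' : A} {t : ℝ} (ht : t ∈ cell l k a)
    (ht' : t ∈ cell l k' a') : k = k' ∧ a = a' := by
  have hk : k = k' := by
    have h1 := h.cell_subset k a ht
    have h2 := h.cell_subset k' a' ht'
    by_contra hne
    rcases lt_or_gt_of_ne hne with hlt | hlt
    · exact absurd (h2.1.trans_lt h1.2) (not_lt.2 (h.start_mono hlt))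
    · exact absurd (h1.1.trans_lt h2.2) (not_lt.2 (h.start_mono hlt))
  subst hk
  exact ⟨rfl, eq_of_mem_Ico_cumMass (h.inc_nonneg k) (h.inc_summable k) (mem_cell_iff.1 ht)
    (mem_cell_iff.1 ht')⟩

theorem exists_mem_cell (h : IsLayering l) {t : ℝ} (ht : 0 ≤ t) :
    ∀ n, t < layerStart l n → ∃ k < n, ∃ a, t ∈ cell l k a
  | 0, hn => absurd hn (not_lt.2 ht)
  | n + 1, hn => by
    by_cases hlt : t < layerStart l n
    · obtain ⟨k, hk, a, ha⟩ := h.exists_mem_cell ht n hlt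
      exact ⟨k, by omega, a, ha⟩
    · have := h.start_succ n
      obtain ⟨a, ha⟩ := exists_mem_Ico_cumMass (h.inc_nonneg n) (h.inc_summable n)
        (t := t - layerStart l n) (by linarith) (by linarith)
      exact ⟨n, by omega, a, mem_cell_iff.2 ha⟩

theorem volume_cell (h : IsLayering l) (k : ℕ) (a : A) :
    volume (cell l k a) = ENNReal.ofReal (layerInc l k a) := by
  rw [cell, Real.volume_Ico, cumMass_encode_succ (h.inc_nonneg k) (h.inc_summable k)]
  congr 1
  ring

end IsLayering

open Classical in
/-- The symbol whose cell, in some layer, contains `t` (an arbitrary symbol if there is none). -/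
def layerSymb [Nonempty A] (l : ℕ → A → ℝ) (t : ℝ) : A :=
  if h : ∃ a k, t ∈ cell l k a then h.choose else Classical.arbitrary A

namespace IsLayering

variable [Nonempty A] {l : ℕ → A → ℝ}

theorem layerSymb_eq (h : IsLayering l) {k : ℕ} {a : A} {t : ℝ} (ht : t ∈ cell l k a) :
    layerSymb l t = a := by
  have hex : ∃ a k, t ∈ cell l k a := ⟨a, k, ht⟩
  obtain ⟨k', hk'⟩ := hex.choose_spec
  rw [layerSymb, dif_pos hex]
  exact (h.cell_unique hk' ht).2

/-- Two layerings whose first layers are the same select the same symbol below the total mass of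
these layers. -/
theorem layerSymb_congr (h : IsLayering l) {l' : ℕ → A → ℝ} (h' : IsLayering l') {n : ℕ}
    (heq : ∀ k ≤ n, l k = l' k) {t : ℝ} (ht : 0 ≤ t) (htn : t < ∑' a, l n a) :
    layerSymb l t = layerSymb l' t := by
  obtain ⟨k, hk, a, ha⟩ := h.exists_mem_cell ht (n + 1) htn
  rw [h.layerSymb_eq ha]
  have hcell : cell l k a = cell l' k a := by
    cases k with
    | zero =>
      have e : layerInc l 0 = layerInc l' 0 := by
        funext b
        simp [layerInc, heq 0 (Nat.zero_le n)]
      simp [cell, layerStart, e]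
    | succ k =>
      have e : layerInc l (k + 1) = layerInc l' (k + 1) := by
        funext b
        simp [layerInc, heq k (by omega), heq (k + 1) (by omega)]
      simp [cell, layerStart, e, heq k (by omega)]
  rw [hcell] at ha
  exact (h'.layerSymb_eq ha).symm

theorem measurableSet_layerSymb (h : IsLayering l) (a : A) :
    MeasurableSet {t | layerSymb l t = a} := by
  have hU : MeasurableSet (⋃ b, ⋃ k, cell l k b) :=
    MeasurableSet.iUnion fun b => MeasurableSet.iUnion fun k => measurableSet_Ico
  have hset : {t | layerSymb l t = a} = (⋃ k, cell l k a) ∪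
      ((⋃ b, ⋃ k, cell l k b)ᶜ ∩ {_t : ℝ | Classical.arbitrary A = a}) := by
    ext t
    simp only [Set.mem_ofPred_eq, Set.mem_union, Set.mem_iUnion, Set.mem_inter_iff, Set.mem_compl_iff]
    by_cases hex : ∃ b k, t ∈ cell l k b
    · obtain ⟨b, k, hb⟩ := hex
      rw [h.layerSymb_eq hb]
      constructor
      · rintro rfl
        exact Or.inl ⟨k, hb⟩
      · rintro (⟨k', hk'⟩ | ⟨hno, -⟩)
        · exact (h.cell_unique hb hk').2
        · exact absurd ⟨b, k, hb⟩ hno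
    · have hno : ¬ ∃ k, t ∈ cell l k a := fun ⟨k, hk⟩ => hex ⟨a, k, hk⟩
      rw [layerSymb, dif_neg hex]
      simp only [hno, hex, not_false_eq_true, true_and, false_or]
  rw [hset]
  exact (MeasurableSet.iUnion fun k => measurableSet_Ico).union (hU.compl.inter (.const _))

/-- If the layers exhaust the unit mass, then the selected symbol has the limit law. -/
theorem volume_layerSymb (h : IsLayering l) {p : A → ℝ}
    (hlim : ∀ a, Tendsto (fun k => l k a) atTop (𝓝 (p a)))
    (hmass : Tendsto (fun k => ∑' a, l k a) atTop (𝓝 1)) (a : A) :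
    volume.restrict (Set.Ico (0 : ℝ) 1) {t | layerSymb l t = a} = ENNReal.ofReal (p a) := by
  have hstart : Tendsto (layerStart l) atTop (𝓝 1) := (tendsto_add_atTop_iff_nat 1).1 hmass
  have hset : {t | layerSymb l t = a} ∩ Set.Ico 0 1 = ⋃ k, cell l k a := by
    ext t
    simp only [Set.mem_inter_iff, Set.mem_ofPred_eq, Set.mem_iUnion]
    constructor
    · rintro ⟨ha, ht0, ht1⟩
      obtain ⟨n, hn⟩ := (hstart.eventually_const_lt ht1).exists
      obtain ⟨k, -, b, hb⟩ := h.exists_mem_cell ht0 n hn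
      rw [h.layerSymb_eq hb] at ha
      exact ⟨k, ha ▸ hb⟩
    · rintro ⟨k, hk⟩
      have h1 := h.cell_subset k a hk
      exact ⟨h.layerSymb_eq hk, (h.start_mono (Nat.zero_le k)).trans h1.1,
        h1.2.trans_le (h.start_mono.ge_of_tendsto hstart (k + 1))⟩
  rw [Measure.restrict_apply (h.measurableSet_layerSymb a), hset, measure_iUnion]
  · simp_rw [h.volume_cell]
    have hs : HasSum (fun k => layerInc l k a) (p a) := by
      rw [hasSum_iff_tendsto_nat_of_nonneg (fun k => h.inc_nonneg k a),
        ← tendsto_add_atTop_iff_nat 1]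
      simpa only [sum_layerInc] using hlim a
    rw [← ENNReal.ofReal_tsum_of_nonneg (fun k => h.inc_nonneg k a) hs.summable, hs.tsum_eq]
  · intro k k' hkk'
    rw [Function.onFun, Set.disjoint_left]
    exact fun t ht ht' => hkk' (h.cell_unique ht ht').1
  · exact fun k => measurableSet_Ico

end IsLayering

end Cells

/-! ### The update function -/

section Update

variable {A : Type u}

theorem take_congr {x y : Stream' A} {n : ℕ} (h : ∀ i < n, x i = y i) : x.take n = y.take n := by
  induction n with
  | zero => simp
  | succ n ih =>
    rw [Stream'.take_succ', Stream'.take_succ', ih fun i hi => h i (by omega)]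
    exact congrArg (fun a => y.take n ++ [a]) (h n (Nat.lt_succ_self n))

theorem take_add (x : Stream' A) (m n : ℕ) : x.take (m + n) = x.take m ++ (x.drop m).take n := by
  induction n with
  | zero => simp
  | succ n ih => 
    rw [← Nat.add_assoc, Stream'.take_succ', Stream'.take_succ', ih, List.append_assoc,
      Stream'.get_drop]

theorem context_eq {τ : Set (PastString A)} (h : IsContextTree τ) {x : Stream' A} {w : PastString A}
    (hw : w ∈ τ) (hwx : w.IsSuffixOf x) : context τ x = w :=
  (h x).unique (context_spec h x) ⟨hw, hwx⟩

/-- A context of length at most `m` is a finite string that can be read off the `m` most recent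
symbols of the past. -/
theorem context_congr {τ : Set (PastString A)} (h : IsContextTree τ) {x y : Stream' A} {m : ℕ}
    (hm : (context τ x).len ≤ m) (hxy : ∀ i < m, x i = y i) : context τ y = context τ x := by
  obtain ⟨hmem, hsuf⟩ := context_spec h x
  cases hc : context τ x with
  | inr w => rw [hc] at hm; exact absurd hm (by simp [PastString.len])
  | inl c =>
    rw [hc] at hm hmem hsuf
    have hcm : c.length ≤ m := by simpa [PastString.len] using hm
    refine context_eq h hmem ?_
    have hx : x.take c.length = c := hsuf
    change y.take c.length = c
    rw [← take_congr fun i hi => hxy i (by omega), hx]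

variable (P : TransitionKernel A)

theorem lowerProb_nonneg (l : List A) (a : A) : 0 ≤ lowerProb P l a :=
  Real.iInf_nonneg fun _ => P.nonneg _ _

theorem lowerProb_le (l : List A) (z : Stream' A) (a : A) : lowerProb P l a ≤ P a (l ++ₛ z) :=
  ciInf_le ⟨0, by rintro _ ⟨z, rfl⟩; exact P.nonneg _ _⟩ z

theorem lowerProb_take_le (x : Stream' A) (n : ℕ) (a : A) : lowerProb P (x.take n) a ≤ P a x := by
  simpa only [Stream'.append_take_drop] using lowerProb_le P (x.take n) (x.drop n) a

theorem alphaNeg_nonneg : 0 ≤ alphaNeg P := tsum_nonneg (lowerProb_nonneg P [])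

theorem alphaCtx_nonneg (v : List A) (k : ℕ) : 0 ≤ alphaCtx P v k :=
  Real.iInf_nonneg fun _ => tsum_nonneg (lowerProb_nonneg P _)

theorem alphaCtx_le (v : List A) {k : ℕ} (b : List.Vector A k) :
    alphaCtx P v k ≤ ∑' a, lowerProb P (v ++ b.toList) a :=
  ciInf_le ⟨0, by rintro _ ⟨b, rfl⟩; exact tsum_nonneg (lowerProb_nonneg P _)⟩ b

variable (τ : Set (PastString A))

theorem bddBelow_alphaUnif (k : ℕ) :
    BddBelow (insert 1 {r : ℝ | ∃ v : List A, Sum.inl v ∈ τ ∧ r = alphaCtx P v k}) :=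
  ⟨0, by rintro _ (rfl | ⟨v, -, rfl⟩); exacts [zero_le_one, alphaCtx_nonneg P v k]⟩

theorem alphaUnif_nonneg (k : ℕ) : 0 ≤ alphaUnif P τ k :=
  Real.sInf_nonneg (by rintro _ (rfl | ⟨v, -, rfl⟩); exacts [zero_le_one, alphaCtx_nonneg P v k])

theorem alphaUnif_le_one (k : ℕ) : alphaUnif P τ k ≤ 1 :=
  csInf_le (bddBelow_alphaUnif P τ k) (Set.mem_insert _ _)

variable {τ} in
theorem alphaUnif_le_tsum (hτ : IsContextTree τ) {x : Stream' A} {c : List A}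
    (hc : context τ x = Sum.inl c) (k : ℕ) :
    alphaUnif P τ k ≤ ∑' a, lowerProb P (x.take (c.length + k)) a := by
  obtain ⟨hmem, hsuf⟩ := context_spec hτ x
  rw [hc] at hmem hsuf
  have hx : x.take c.length = c := hsuf
  calc alphaUnif P τ k ≤ alphaCtx P c k :=
        csInf_le (bddBelow_alphaUnif P τ k) (Set.mem_insert_of_mem _ ⟨c, hmem, rfl⟩)
    _ ≤ _ := by
        rw [take_add, hx]
        exact alphaCtx_le P c ⟨(x.drop c.length).take k, by simp⟩

/-- The layers of mass used by the update function after the past `x`: layer `0` holds the masses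
`α(a)`, and the layers up to `k + 1` hold together the masses `inf_z P(a | w z)`, where `w` is the
context of `x` followed, back in time, by `k` more symbols of `x`.  After an infinite context, all
the missing mass is put into layer `1`. -/
def ctxLayers (x : Stream' A) : ℕ → A → ℝ
  | 0, a => alphaSymb P a
  | k + 1, a => Sum.elim (fun c => lowerProb P (x.take (c.length + k)) a) (fun _ => P a x)
      (context τ x)

variable {τ} in
theorem alphaUnif_le_tsum_ctxLayers (hτ : IsContextTree τ) (x : Stream' A) (k : ℕ) :
    alphaUnif P τ k ≤ ∑' a, ctxLayers P τ x (k + 1) a := by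
  cases hc : context τ x with
  | inl c => simpa [ctxLayers, hc] using alphaUnif_le_tsum P hτ hc k
  | inr w => 
    have := (P.hasSum x).tsum_eq
    simp only [ctxLayers, hc, Sum.elim_inr, this]
    exact alphaUnif_le_one P τ k

theorem ctxLayers_le (x : Stream' A) (a : A) : ∀ k, ctxLayers P τ x k a ≤ P a x
  | 0 => lowerProb_take_le P x 0 a
  | k + 1 => by
    cases hc : context τ x with
    | inl c => simpa [ctxLayers, hc] using lowerProb_take_le P x _ a
    | inr w => simp [ctxLayers, hc]

theorem inSymbInterval_iff [Encodable A] {t : ℝ} {a : A} : InSymbInterval P t a ↔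
    t ∈ Set.Ico (cumMass (alphaSymb P) (Encodable.encode a))
      (cumMass (alphaSymb P) (Encodable.encode a + 1)) := by
  simp only [InSymbInterval, cumMass, Set.mem_Ico, Nat.lt_succ_iff]

variable [Nonempty A]

theorem lowerProb_le_append (l l' : List A) (a : A) :
    lowerProb P l a ≤ lowerProb P (l ++ l') a := by
  have : Nonempty (Stream' A) := ⟨Stream'.const (Classical.arbitrary A)⟩
  refine le_ciInf fun z => ?_
  rw [Stream'.append_append_stream]
  exact lowerProb_le P l _ a

theorem lowerProb_take_mono (x : Stream' A) {m n : ℕ} (h : m ≤ n) (a : A) :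
    lowerProb P (x.take m) a ≤ lowerProb P (x.take n) a := by
  obtain ⟨k, rfl⟩ := Nat.exists_eq_add_of_le h
  rw [take_add]
  exact lowerProb_le_append P _ _ a

theorem alphaSymb_le_lowerProb (l : List A) (a : A) : alphaSymb P a ≤ lowerProb P l a :=
  lowerProb_le_append P [] l a

theorem summable_lowerProb (l : List A) : Summable (lowerProb P l) :=
  Summable.of_nonneg_of_le (lowerProb_nonneg P l)
    (lowerProb_le P l (Stream'.const (Classical.arbitrary A))) (P.hasSum _).summable

theorem tsum_lowerProb_le_one (l : List A) : ∑' a, lowerProb P l a ≤ 1 := by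
  have h := P.hasSum (l ++ₛ Stream'.const (Classical.arbitrary A))
  rw [← h.tsum_eq]
  exact (summable_lowerProb P l).tsum_le_tsum (lowerProb_le P l _) h.summable

theorem alphaNeg_le_one : alphaNeg P ≤ 1 := tsum_lowerProb_le_one P []

theorem isLayering_ctxLayers (x : Stream' A) : IsLayering (ctxLayers P τ x) where
  nonneg := lowerProb_nonneg P []
  mono k a := by
    cases hc : context τ x with
    | inl c =>
      cases k with
      | zero => simpa [ctxLayers, hc] using alphaSymb_le_lowerProb P _ a
      | succ k => simpa [ctxLayers, hc] using lowerProb_take_mono P x (by omega) a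
    | inr w =>
      cases k with
      | zero => simpa [ctxLayers, hc] using ctxLayers_le P τ x a 0
      | succ k => simp [ctxLayers, hc]
  summable k := by
    cases k with
    | zero => exact summable_lowerProb P []
    | succ k =>
      cases hc : context τ x with
      | inl c =>
        refine (summable_lowerProb P (x.take (c.length + k))).congr fun a => ?_
        simp [ctxLayers, hc]
      | inr w =>
        refine (P.hasSum x).summable.congr fun a => ?_
        simp [ctxLayers, hc]

variable {τ}

theorem tsum_ctxLayers_le_one (x : Stream' A) : ∀ k, ∑' a, ctxLayers P τ x k a ≤ 1
  | 0 => alphaNeg_le_one P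
  | k + 1 => by
    cases hc : context τ x with
    | inl c => simpa [ctxLayers, hc] using tsum_lowerProb_le_one P _
    | inr w => simpa [ctxLayers, hc] using (P.hasSum x).tsum_eq.le

theorem tendsto_tsum_ctxLayers (hτ : IsContextTree τ) (hU : IsULC P τ) (x : Stream' A) :
    Tendsto (fun k => ∑' a, ctxLayers P τ x k a) atTop (𝓝 1) :=
  (tendsto_add_atTop_iff_nat 1).1 <| tendsto_of_tendsto_of_tendsto_of_le_of_le hU
    tendsto_const_nhds (alphaUnif_le_tsum_ctxLayers P hτ x) fun _ => tsum_ctxLayers_le_one P x _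

theorem tendsto_ctxLayers (hτ : IsContextTree τ) (hU : IsULC P τ) (x : Stream' A) (a : A) :
    Tendsto (fun k => ctxLayers P τ x k a) atTop (𝓝 (P a x)) := by
  have hlim : Tendsto (fun k => P a x - (1 - ∑' b, ctxLayers P τ x k b)) atTop (𝓝 (P a x)) := by
    simpa using (tendsto_const_nhds (x := P a x)).sub
      ((tendsto_const_nhds (x := (1 : ℝ))).sub (tendsto_tsum_ctxLayers P hτ hU x))
  refine tendsto_of_tendsto_of_tendsto_of_le_of_le hlim tendsto_const_nhds (fun k => ?_)
    fun k => ctxLayers_le P τ x a k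
  have hs := (P.hasSum x).summable.sub ((isLayering_ctxLayers P τ x).summable k)
  have h1 := hs.le_tsum a fun b _ => sub_nonneg.2 (ctxLayers_le P τ x b k)
  rw [(P.hasSum x).summable.tsum_sub ((isLayering_ctxLayers P τ x).summable k),
    (P.hasSum x).tsum_eq] at h1
  linarith

variable [Encodable A]
variable (τ)

/-- The update function: the symbol selected by the layers of the past. -/
def update (x : Stream' A) (t : ℝ) : A := layerSymb (ctxLayers P τ x) t

variable {τ}

theorem isUpdateFunction_update (hτ : IsContextTree τ) (hU : IsULC P τ) :
    IsUpdateFunction P (update P τ) := fun x a =>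
  ⟨(isLayering_ctxLayers P τ x).measurableSet_layerSymb a,
    (isLayering_ctxLayers P τ x).volume_layerSymb (tendsto_ctxLayers P hτ hU x)
      (tendsto_tsum_ctxLayers P hτ hU x) a⟩

theorem symbY_eq_some_iff {t : ℝ} {a : A} : symbY P t = some a ↔ InSymbInterval P t a := by
  rw [symbY]
  split_ifs with h
  · rw [Option.some_inj]
    refine ⟨fun he => he ▸ h.choose_spec, fun ha => ?_⟩
    exact eq_of_mem_Ico_cumMass (lowerProb_nonneg P []) (summable_lowerProb P [])
      ((inSymbInterval_iff P).1 h.choose_spec) ((inSymbInterval_iff P).1 ha)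
  · simp [not_exists.1 h a]

theorem symbY_ne_none {t : ℝ} (h0 : 0 ≤ t) (h1 : t < alphaNeg P) : symbY P t ≠ none := by
  obtain ⟨a, ha⟩ := exists_mem_Ico_cumMass (lowerProb_nonneg P []) (summable_lowerProb P []) h0 h1
  rw [(symbY_eq_some_iff P).2 ((inSymbInterval_iff P).2 ha)]
  simp

theorem update_of_symbY {x : Stream' A} {t : ℝ} {a : A} (h : symbY P t = some a) :
    update P τ x t = a := by
  refine (isLayering_ctxLayers P τ x).layerSymb_eq (k := 0) ?_
  rw [mem_cell_iff]
  have e : layerInc (ctxLayers P τ x) 0 = alphaSymb P := rfl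
  rw [e]
  simpa [layerStart] using (inSymbInterval_iff P).1 ((symbY_eq_some_iff P).1 h)

/-- Below `α_k`, the update function only reads the context and `k` more symbols. -/
theorem update_congr (hτ : IsContextTree τ) {x y : Stream' A} {m k : ℕ}
    (hm : (context τ x).len ≤ m) (hxy : ∀ i < m + k, x i = y i) {t : ℝ} (h0 : 0 ≤ t)
    (ht : t < alphaUnif P τ k) : update P τ x t = update P τ y t := by
  have hctx := context_congr hτ hm fun i hi => hxy i (by omega)
  refine (isLayering_ctxLayers P τ x).layerSymb_congr (isLayering_ctxLayers P τ y) (n := k + 1)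
    (fun j hj => ?_) h0 (ht.trans_le (alphaUnif_le_tsum_ctxLayers P hτ x k))
  cases hc : context τ x with
  | inr w => rw [hc] at hm; exact absurd hm (by simp [PastString.len])
  | inl c =>
    rw [hc] at hm
    have hcm : c.length ≤ m := by simpa [PastString.len] using hm
    cases j with
    | zero => rfl
    | succ j =>
      funext a
      simp only [ctxLayers, hctx, hc, Sum.elim_inl]
      rw [take_congr fun i hi => hxy i (by omega)]

end Update

/-! ### Blocks of a sequence -/

section Blocks

/-- The sequence that is left when its first block, of length `T v`, is removed. -/
def blockShift (T : (ℕ → ℝ) → ℕ) (v : ℕ → ℝ) : ℕ → ℝ := fun i => v (T v + i)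

/-- The total length of the first `k` blocks. -/
def blockStart (T : (ℕ → ℝ) → ℕ) (v : ℕ → ℝ) (k : ℕ) : ℕ :=
  ∑ i ∈ Finset.range k, T ((blockShift T)^[i] v)

theorem blockStart_succ (T : (ℕ → ℝ) → ℕ) (v : ℕ → ℝ) (k : ℕ) :
    blockStart T v (k + 1) = blockStart T v k + T ((blockShift T)^[k] v) :=
  Finset.sum_range_succ _ _

theorem iterate_blockShift_apply (T : (ℕ → ℝ) → ℕ) (v : ℕ → ℝ) (k i : ℕ) :
    (blockShift T)^[k] v i = v (blockStart T v k + i) := by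
  induction k generalizing i with
  | zero => simp [blockStart]
  | succ k ih =>
    rw [Function.iterate_succ_apply', blockShift, ih, blockStart_succ, add_assoc]

/-- The values of `M` on the successive tails of `v` that begin with a block. -/
def blockSeq (T M : (ℕ → ℝ) → ℕ) (v : ℕ → ℝ) : ℕ → ℕ := fun k => M ((blockShift T)^[k] v)

/-- If block `k` needs to know `x k` symbols behind it, then `Closed x r` says that no one of the
blocks `0, …, r` looks behind block `r` (blocks have length at least one). -/
def Closed (x : ℕ → ℕ) (r : ℕ) : Prop := ∀ k ≤ r, x k ≤ r - k

theorem blockStart_add_le {T : (ℕ → ℝ) → ℕ} {v : ℕ → ℝ} {n : ℕ}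
    (hT : ∀ k < n, 0 < T ((blockShift T)^[k] v)) {k : ℕ} (m : ℕ) (h : k + m ≤ n) :
    blockStart T v k + m ≤ blockStart T v (k + m) := by
  induction m with
  | zero => simp
  | succ m ih =>
    have h1 := ih (by omega)
    have h2 := hT (k + m) (by omega)
    rw [← add_assoc k m 1, blockStart_succ]
    omega

theorem exists_block (T : (ℕ → ℝ) → ℕ) (v : ℕ → ℝ) {q : ℕ} :
    ∀ n, q < blockStart T v n → ∃ k < n, blockStart T v k ≤ q ∧ q < blockStart T v (k + 1)
  | 0, h => by simp [blockStart] at h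
  | n + 1, h => by
    by_cases hq : q < blockStart T v n
    · obtain ⟨k, hk, h1⟩ := exists_block T v n hq
      exact ⟨k, by omega, h1⟩
    · exact ⟨n, by omega, by omega, h⟩

end Blocks

/-! ### Good blocks and coalescence -/

section GoodBlocks

section Rank

variable {A : Type u} (P : TransitionKernel A) (τ : Set (PastString A))

/-- The bounds `β₀ = α₋₁` and `β_k = α_k` for `k ≥ 1`. -/
def memRate (k : ℕ) : ℝ := if k = 0 then alphaNeg P else alphaUnif P τ k

/-- The least `k` with `t < β_k`: a symbol that is constructed from the number `t` depends on the
context and on at most `k` more symbols.  It is `0` if there is no such `k`; uniform local continuity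
excludes this for `t < 1`. -/
def rank (t : ℝ) : ℕ := sInf {k | t < memRate P τ k}

variable {P τ}

theorem lt_memRate_rank (hU : IsULC P τ) {t : ℝ} (ht : t < 1) : t < memRate P τ (rank P τ t) := by
  have hex : ∃ k, t < memRate P τ k := by
    obtain ⟨k, hk, hk0⟩ := ((hU.eventually_const_lt ht).and (eventually_gt_atTop 0)).exists
    exact ⟨k, by rwa [memRate, if_neg hk0.ne']⟩
  exact Nat.sInf_mem hex

theorem rank_le {t : ℝ} {k : ℕ} (h : t < memRate P τ k) : rank P τ t ≤ k := Nat.sInf_le h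

end Rank

variable {A : Type u} [Encodable A] (P : TransitionKernel A) (τ : Set (PastString A))

/-- The largest length of a context of a past whose known symbols are those given by `v`, the
stars being filled arbitrarily. -/
def maxLen (v : ℕ → ℝ) : ℕ∞ :=
  ⨆ a : ℕ → A, (context τ fun k => (symbY P (v k)).getD (a k)).len

theorem maxContextLen_eq (u : ℤ → ℝ) (n : ℤ) :
    maxContextLen P τ u n = maxLen P τ fun k => u (n - k) := by
  refine le_antisymm (iSup_le fun a => le_iSup_of_le (fun k : ℕ => a (n - k)) le_rfl)
    (iSup_le fun a => le_iSup_of_le (fun i : ℤ => a (n - i).toNat) (le_of_eq ?_))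
  congr 2
  funext k
  simp [filledPast]

/-- Read backwards, the first `t` entries of `v` form a good block: each of them gives a symbol, or
finds its context among the older entries of the block. -/
def GoodDepth (v : ℕ → ℝ) (t : ℕ) : Prop :=
  ∀ j < t, symbY P (v j) ≠ none ∨ maxLen P τ (fun i => v (j + 1 + i)) ≤ (t - 1 - j : ℕ)

theorem mem_goodTimes_iff (u : ℤ → ℝ) (m : ℤ) (t : ℕ) :
    m - t ∈ goodTimes P τ u m ↔ GoodDepth P τ (fun k : ℕ => u (m - k)) (t + 1) := by
  have key : ∀ j : ℕ, j < t + 1 →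
      ((symbY P (u (m - j)) ≠ none ∨
        maxContextLen P τ u (m - j - 1) ≤ ((m - j - (m - t)).toNat : ℕ∞)) ↔
      (symbY P (u (m - j)) ≠ none ∨
        maxLen P τ (fun i : ℕ => u (m - (j + 1 + i : ℕ))) ≤ (t + 1 - 1 - j : ℕ))) := by
    intro j hj
    rw [maxContextLen_eq]
    have e1 : (m - j - (m - t)).toNat = t + 1 - 1 - j := by omega
    have e2 : (fun k : ℕ => u (m - j - 1 - k)) = fun i : ℕ => u (m - (j + 1 + i : ℕ)) := by
      funext i
      congr 1
      push_cast
      ring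
    rw [e1, e2]
  constructor
  · rintro ⟨-, h⟩ j hj
    exact (key j hj).1 (h (m - j) (by omega) (by omega))
  · intro h
    refine ⟨by omega, fun i hi hi' => ?_⟩
    obtain ⟨j, rfl⟩ : ∃ j : ℕ, i = m - j := ⟨(m - i).toNat, by omega⟩
    exact (key j (by omega)).2 (h j (by omega))

/-- The length of the shortest good block at the start of `v`; it is `0` if there is none. -/
def blockLen (v : ℕ → ℝ) : ℕ := sInf {t | 0 < t ∧ GoodDepth P τ v t}

/-- The length of the first good block, infinite if there is none. -/
def blockLenE (v : ℕ → ℝ) : ℝ≥0∞ := if blockLen P τ v = 0 then ⊤ else blockLen P τ v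

variable {P τ} in
theorem goodDepth_blockLen {v : ℕ → ℝ} (h : 0 < blockLen P τ v) :
    GoodDepth P τ v (blockLen P τ v) :=
  (Nat.sInf_mem (Nat.nonempty_of_pos_sInf h)).2

theorem abs_goodTheta_add_one (u : ℤ → ℝ) :
    (goodTheta P τ u 0).abs + 1 =
      blockLenE P τ fun k => u (0 - k) := by
  set v : ℕ → ℝ := fun k => u (0 - k) with hv
  have hmem : ∀ t : ℕ, (-t : ℤ) ∈ goodTimes P τ u 0 ↔ GoodDepth P τ v (t + 1) := by
    intro t
    simpa [hv] using mem_goodTimes_iff P τ u 0 t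
  rw [blockLenE]
  split_ifs with h0
  · have hempty : goodTimes P τ u 0 = ∅ := by
      refine Set.eq_empty_of_forall_notMem fun i hi => ?_
      obtain ⟨t, rfl⟩ : ∃ t : ℕ, i = -t := ⟨(-i).toNat, by have := hi.1; omega⟩
      rcases Nat.sInf_eq_zero.1 h0 with h | h
      · exact absurd h.1 (lt_irrefl 0)
      · exact Set.eq_empty_iff_forall_notMem.1 h (t + 1) ⟨t.succ_pos, (hmem t).1 hi⟩
    simp [goodTheta, hempty]
  · have hgood := goodDepth_blockLen (Nat.pos_of_ne_zero h0)
    obtain ⟨t, ht⟩ := Nat.exists_eq_succ_of_ne_zero h0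
    rw [ht] at hgood
    have hg : IsGreatest ((fun i : ℤ => ((i : ℝ) : EReal)) '' goodTimes P τ u 0)
        (((-t : ℤ) : ℝ) : EReal) := by
      refine ⟨⟨-t, (hmem t).2 hgood, rfl⟩, ?_⟩
      rintro _ ⟨i, hi, rfl⟩
      obtain ⟨s, rfl⟩ : ∃ s : ℕ, i = -s := ⟨(-i).toNat, by have := hi.1; omega⟩
      have hs : blockLen P τ v ≤ s + 1 := Nat.sInf_le ⟨s.succ_pos, (hmem s).1 hi⟩
      simp only [EReal.coe_le_coe_iff]
      exact_mod_cast (by omega : -(s : ℤ) ≤ -(t : ℤ))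
    rw [goodTheta, hg.csSup_eq, ht, EReal.abs_def]
    simp

/-- The largest rank in the good block at the start of `v`. -/
def blockRank (v : ℕ → ℝ) : ℕ := (Finset.range (blockLen P τ v)).sup fun j => rank P τ (v j)

variable {P τ}

variable [Nonempty A]

theorem runFrom_of_symbY (u : ℤ → ℝ) (k : ℤ) (x : Stream' A) (t i : ℕ) (hi : i < t) {a : A}
    (ha : symbY P (u (k + t - 1 - i)) = some a) : runFrom (update P τ) u k x t i = a := by
  induction t generalizing i with
  | zero => omega
  | succ t ih =>
    cases i with
    | zero =>
      refine update_of_symbY P ?_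
      rw [← ha]
      congr 2
      push_cast
      ring
    | succ i =>
      refine ih i (by omega) ?_
      rw [← ha]
      congr 2
      push_cast
      ring

/-- If the blocks `0, …, r` behind time `n` are closed, then the symbols constructed from the left
end of block `r` do not depend on the past of that time. -/
theorem runFrom_congr (hτ : IsContextTree τ) (hU : IsULC P τ) (u : ℤ → ℝ) (n : ℤ) (v : ℕ → ℝ)
    (hv : v = fun k : ℕ => u (n - k)) (h01 : ∀ i, v i ∈ Set.Ico (0 : ℝ) 1) {r : ℕ}
    (hpos : ∀ k < r + 1, 0 < blockLen P τ ((blockShift (blockLen P τ))^[k] v))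
    (hr : Closed (blockSeq (blockLen P τ) (blockRank P τ) v) r) (x y : Stream' A) (t : ℕ)
    (ht : t ≤ blockStart (blockLen P τ) v (r + 1)) :
    ∀ i < t, runFrom (update P τ) u (n - blockStart (blockLen P τ) v (r + 1) + 1) x t i =
      runFrom (update P τ) u (n - blockStart (blockLen P τ) v (r + 1) + 1) y t i := by
  have hvq : ∀ q : ℕ, v q = u (n - q) := fun q => by rw [hv]
  set T := blockLen P τ with hT
  set L := blockStart T v (r + 1) with hL
  induction t with
  | zero => intro i hi; omega
  | succ t ih =>
    have ih := ih (by omega)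
    intro i hi
    cases i with
    | succ i => exact ih i (by omega)
    | zero =>
      set X := runFrom (update P τ) u (n - L + 1) x t with hX
      set Y := runFrom (update P τ) u (n - L + 1) y t with hY
      -- The symbol number `q` behind time `n` is constructed.
      obtain ⟨q, hq⟩ : ∃ q, t + q + 1 = L := ⟨L - 1 - t, by omega⟩
      have huq : u (n - L + 1 + t) = v q := by
        rw [hvq]
        congr 1
        omega
      change update P τ X (u (n - L + 1 + t)) = update P τ Y (u (n - L + 1 + t))
      rw [huq]
      by_cases hsy : symbY P (v q) = none
      swap
      · obtain ⟨a, ha⟩ := Option.ne_none_iff_exists'.1 hsy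
        rw [update_of_symbY P ha, update_of_symbY P ha]
      obtain ⟨k, hk, hkq, hqk⟩ := exists_block T v (r + 1) (show q < L by omega)
      obtain ⟨j, rfl⟩ := Nat.exists_eq_add_of_le hkq
      rw [blockStart_succ] at hqk
      have hgood : symbY P ((blockShift T)^[k] v j) ≠ none ∨
          maxLen P τ (fun i => (blockShift T)^[k] v (j + 1 + i)) ≤
            (T ((blockShift T)^[k] v) - 1 - j : ℕ) :=
        goodDepth_blockLen (hpos k hk) j (show j < T ((blockShift T)^[k] v) by omega)
      rw [iterate_blockShift_apply] at hgood
      have hlen := hgood.resolve_left fun h => h hsy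
      have hgrow := blockStart_add_le hpos (k := k + 1) (r - k) (by omega)
      rw [show k + 1 + (r - k) = r + 1 by omega, blockStart_succ] at hgrow
      set d := T ((blockShift T)^[k] v) - 1 - j with hd
      have hrank : rank P τ (v (blockStart T v k + j)) ≤ r - k := by
        refine le_trans ?_ (hr k (by omega))
        rw [← iterate_blockShift_apply T v k j]
        exact Finset.le_sup (s := Finset.range (T ((blockShift T)^[k] v))) (f := fun j => rank P τ ((blockShift T)^[k] v j))
          (Finset.mem_range.2 (by omega))
      have hlt := lt_memRate_rank hU (h01 (blockStart T v k + j)).2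
      have hrank0 : rank P τ (v (blockStart T v k + j)) ≠ 0 := by
        intro h0
        rw [h0, memRate, if_pos rfl] at hlt
        exact symbY_ne_none P (h01 _).1 hlt hsy
      rw [memRate, if_neg hrank0] at hlt
      -- The past is one way of filling the stars of the block.
      set z : Stream' A := fun i =>
        (symbY P ((blockShift T)^[k] v (j + 1 + i))).getD (X i) with hz
      have hzlen : (context τ z).len ≤ d :=
        (le_iSup (fun a : ℕ → A => (context τ fun i =>
          (symbY P ((blockShift T)^[k] v (j + 1 + i))).getD (a i)).len) X).trans hlen
      have hzX : ∀ i < d, z i = X i := by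
        intro i hi
        simp only [hz, iterate_blockShift_apply]
        cases hs : symbY P (v (blockStart T v k + (j + 1 + i))) with
        | none => rfl
        | some a =>
          refine (runFrom_of_symbY u _ x t i (by omega) ?_).symm
          have e : u (n - L + 1 + t - 1 - i) = v (blockStart T v k + (j + 1 + i)) := by
            rw [hvq]
            refine congrArg u ?_
            push_cast
            omega
          rw [e]
          exact hs
      have hctx := context_congr hτ hzlen hzX
      refine update_congr P hτ (m := d) (hctx ▸ hzlen) (fun i hi => ih i ?_) (h01 _).1 hlt
      omega

/-- Closed blocks bound the coalescence time from below. -/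
theorem le_theta (hτ : IsContextTree τ) (hU : IsULC P τ) (u : ℤ → ℝ) (n : ℤ) (v : ℕ → ℝ)
    (hv : v = fun k : ℕ => u (n - k)) (h01 : ∀ i, v i ∈ Set.Ico (0 : ℝ) 1) {r : ℕ}
    (hpos : ∀ k < r + 1, 0 < blockLen P τ ((blockShift (blockLen P τ))^[k] v))
    (hr : Closed (blockSeq (blockLen P τ) (blockRank P τ) v) r) :
    (((n - blockStart (blockLen P τ) v (r + 1) + 1 : ℤ) : ℝ) : EReal) ≤
      theta (update P τ) u n n := by
  have hL := blockStart_add_le hpos (k := 0) (r + 1) (by omega)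
  rw [Nat.zero_add] at hL
  obtain ⟨l, hl⟩ : ∃ l, blockStart (blockLen P τ) v (r + 1) = l + 1 :=
    ⟨blockStart (blockLen P τ) v (r + 1) - 1, by omega⟩
  refine le_sSup ⟨_, ⟨by omega, fun i hi hi' x y => ?_⟩, rfl⟩
  obtain rfl : n = i := le_antisymm hi hi'
  have := runFrom_congr hτ hU u n v hv h01 hpos hr x y (l + 1) hl.ge 0 l.succ_pos
  rw [hl] at this ⊢
  have e : n - (l + 1 : ℕ) + 1 + (l : ℤ) = n := by push_cast; ring
  have e' : (n - (n - (l + 1 : ℕ) + 1)).toNat = l := by push_cast; omega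
  have hnew : ∀ w, runFrom (update P τ) u (n - (l + 1 : ℕ) + 1) w (l + 1) 0 =
      update P τ (runFrom (update P τ) u (n - (l + 1 : ℕ) + 1) w l) (u n) := fun w => by
    conv_rhs => rw [← e]
    simp only [e]
    change update P τ _ (u (n - (l + 1 : ℕ) + 1 + (l : ℤ))) = _
    rw [e]
  rw [hnew, hnew] at this
  simpa only [iterF, e'] using this

end GoodBlocks

section Theta

variable {A : Type u} {F : Stream' A → ℝ → A} {u : ℤ → ℝ}

theorem theta_ne_bot_iff {m n : ℤ} : theta F u m n ≠ ⊥ ↔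
    ∃ j ≤ m, ∀ i, m ≤ i → i ≤ n → ∀ x y : Stream' A, iterF F u j i x = iterF F u j i y := by
  rw [theta, Ne, sSup_eq_bot]
  simp only [Set.mem_image, Set.mem_ofPred_eq]
  push Not
  constructor
  · rintro ⟨_, ⟨j, hj, -⟩, -⟩
    exact ⟨j, hj⟩
  · rintro ⟨j, hj⟩
    exact ⟨_, ⟨j, hj, rfl⟩, EReal.coe_ne_bot _⟩

theorem theta_le (m n : ℤ) : theta F u m n ≤ ((m : ℝ) : EReal) := by
  refine sSup_le ?_
  rintro _ ⟨j, ⟨hj, -⟩, rfl⟩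
  simp only [EReal.coe_le_coe_iff]
  exact_mod_cast hj

theorem runFrom_add (k : ℤ) (x : Stream' A) (s t : ℕ) :
    runFrom F u k x (s + t) = runFrom F u (k + s) (runFrom F u k x s) t := by
  induction t with
  | zero => rfl
  | succ t ih =>
    rw [← add_assoc, runFrom, runFrom, ih]
    congr 3
    push_cast
    ring

/-- Coalescence persists when the construction starts earlier. -/
theorem iterF_congr_of_le {j j' i : ℤ} (hjj : j' ≤ j) (hji : j ≤ i)
    (h : ∀ x y : Stream' A, iterF F u j i x = iterF F u j i y) (x y : Stream' A) :
    iterF F u j' i x = iterF F u j' i y := by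
  obtain ⟨s, rfl⟩ : ∃ s : ℕ, j = j' + s := ⟨(j - j').toNat, by omega⟩
  obtain ⟨t, rfl⟩ : ∃ t : ℕ, i = j' + s + t := ⟨(i - (j' + s)).toNat, by omega⟩
  have h1 := h (runFrom F u j' x s) (runFrom F u j' y s)
  have e : (j' + s + t - (j' + s)).toNat = t := by omega
  have e' : (j' + s + t - j').toNat = s + t := by omega
  simp only [iterF, e, e', runFrom_add] at h1 ⊢
  exact h1

/-- A window coalesces as soon as each of its times does. -/
theorem theta_ne_bot_of_forall {m n : ℤ} (h : ∀ i, theta F u i i ≠ ⊥) : theta F u m n ≠ ⊥ := by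
  simp only [theta_ne_bot_iff] at h ⊢
  choose j hj hjc using h
  obtain ⟨b, hb⟩ := ((Set.finite_Icc m n).image j).bddBelow
  refine ⟨min b m, min_le_right _ _, fun i hmi hin => ?_⟩
  exact iterF_congr_of_le ((min_le_left _ _).trans (hb ⟨i, ⟨hmi, hin⟩, rfl⟩)) (hj i)
    (hjc i i le_rfl le_rfl)

end Theta

/-! ### Regeneration of independent sequences at the ends of blocks -/

section Regeneration

/-- The law of a sequence of independent variables with law `ρ`. -/
abbrev iidLaw (ρ : Measure ℝ) : Measure (ℕ → ℝ) := Measure.infinitePi fun _ => ρ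

theorem measurable_blockShift {T : (ℕ → ℝ) → ℕ} (hT : Measurable T) : Measurable (blockShift T) := by
  refine measurable_pi_lambda _ fun i => ?_
  have : (fun v => blockShift T v i) = (
      fun q : (ℕ → ℝ) × ℕ => q.1 (q.2 + i)) ∘ fun v => (v, T v) := rfl
  rw [this]
  exact (measurable_from_prod_countable_left fun n => measurable_pi_apply (n + i)).comp
    (measurable_id.prodMk hT)

variable (ρ : Measure ℝ)

/-- A rule that cuts off blocks: the length `T` of the first block is almost surely positive, and
when it is positive, it is determined by the entries of the block, as is the number `M`. -/
structure IsBlockRule (T M : (ℕ → ℝ) → ℕ) : Prop where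
  measurable_len : Measurable T
  measurable_mem : Measurable M
  len_pos : ∀ᵐ v ∂iidLaw ρ, 0 < T v
  len_congr : ∀ v w : ℕ → ℝ, 0 < T v → (∀ i < T v, v i = w i) → T w = T v
  mem_congr : ∀ v w : ℕ → ℝ, 0 < T v → (∀ i < T v, v i = w i) → M w = M v

variable [IsProbabilityMeasure ρ]

theorem lintegral_shift (t : ℕ) {g : (ℕ → ℝ) → ℝ≥0∞} (hg : Measurable g) :
    ∫⁻ v, g (fun i => v (t + i)) ∂iidLaw ρ = ∫⁻ v, g v ∂iidLaw ρ := by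
  have h := Measure.map_infinitePi_infinitePi_of_inj (P := fun _ : ℕ => ρ)
    (add_right_injective t : Function.Injective fun i => t + i)
  conv_rhs => rw [iidLaw, ← h]
  rw [lintegral_map hg (by fun_prop)]

theorem lintegral_mul_shift (t : ℕ) {f g : (ℕ → ℝ) → ℝ≥0∞} (hf : Measurable f) (hg : Measurable g)
    (hft : ∀ v w : ℕ → ℝ, (∀ i < t, v i = w i) → f v = f w) :
    ∫⁻ v, f v * g (fun i => v (t + i)) ∂iidLaw ρ =
      (∫⁻ v, f v ∂iidLaw ρ) * ∫⁻ v, g v ∂iidLaw ρ := by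
  have hind : iIndepFun (fun (i : ℕ) (v : ℕ → ℝ) => v i) (iidLaw ρ) :=
    iIndepFun_infinitePi (X := fun _ (r : ℝ) => r) fun _ => measurable_id
  have hle : ∀ i : ℕ, MeasurableSpace.comap (fun v : ℕ → ℝ => v i) inferInstance ≤
      (inferInstance : MeasurableSpace (ℕ → ℝ)) := fun i => (measurable_pi_apply i).comap_le
  have hdisj : Disjoint {i : ℕ | i < t} {i : ℕ | t ≤ i} := by
    rw [Set.disjoint_left]
    exact fun i hi hi' => absurd (show i < t from hi) (not_lt.2 hi')
  have hindep := indep_iSup_of_disjoint hle hind hdisj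
  have hcoord : ∀ (s : Set ℕ) (i : ℕ), i ∈ s →
      Measurable[⨆ j ∈ s, MeasurableSpace.comap (fun v : ℕ → ℝ => v j) inferInstance]
        fun v : ℕ → ℝ => v i := fun s i hi =>
    Measurable.mono (comap_measurable _) (le_iSup₂_of_le i hi le_rfl) le_rfl
  rw [← lintegral_shift ρ t hg]
  refine lintegral_mul_eq_lintegral_mul_lintegral_of_independent_measurableSpace
    (iSup₂_le fun i _ => hle i) (iSup₂_le fun i _ => hle i) hindep ?_ ?_
  · have htr : f = f ∘ fun (v : ℕ → ℝ) (i : ℕ) => if i < t then v i else 0 := by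
      funext v
      exact hft _ _ fun i hi => by simp [hi]
    rw [htr]
    refine hf.comp (@measurable_pi_lambda _ _ _ (_) _ _ fun i => ?_)
    by_cases hi : i < t
    · simpa [hi] using hcoord {i : ℕ | i < t} i hi
    · simp [hi]
  · exact hg.comp (@measurable_pi_lambda _ _ _ (_) _ _ fun i =>
      hcoord {i : ℕ | t ≤ i} (t + i) (Nat.le_add_right t i))

namespace IsBlockRule

variable {ρ} {T M : (ℕ → ℝ) → ℕ}

/-- The sequence regenerates at the end of the block. -/
theorem lintegral_mul_blockShift (h : IsBlockRule ρ T M) {f g : (ℕ → ℝ) → ℝ≥0∞}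
    (hf : Measurable f) (hg : Measurable g)
    (hfT : ∀ v w : ℕ → ℝ, 0 < T v → (∀ i < T v, v i = w i) → f w = f v) :
    ∫⁻ v, f v * g (blockShift T v) ∂iidLaw ρ =
      (∫⁻ v, f v ∂iidLaw ρ) * ∫⁻ v, g v ∂iidLaw ρ := by
  have hm : ∀ t, MeasurableSet {v | T v = t} := fun t =>
    h.measurable_len (measurableSet_singleton t)
  have hsum : ∀ k : (ℕ → ℝ) → ℝ≥0∞, Measurable k →
      ∫⁻ v, k v ∂iidLaw ρ = ∑' t, ∫⁻ v, {v | T v = t}.indicator k v ∂iidLaw ρ := by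
    intro k hk
    rw [← lintegral_tsum fun t => (hk.indicator (hm t)).aemeasurable]
    refine lintegral_congr fun v => ?_
    rw [tsum_eq_single (T v)]
    · simp
    · intro t ht
      exact Set.indicator_of_notMem (by exact fun h => ht (Eq.symm h)) _
  rw [hsum (fun v => f v * g (blockShift T v)) (hf.mul (hg.comp (measurable_blockShift h.measurable_len))), hsum f hf, ← ENNReal.tsum_mul_right]
  refine tsum_congr fun t => ?_
  rcases Nat.eq_zero_or_pos t with rfl | ht
  · have hzero : ∀ k : (ℕ → ℝ) → ℝ≥0∞, ∫⁻ v, {v | T v = 0}.indicator k v ∂iidLaw ρ = 0 := by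
      intro k
      rw [← lintegral_zero (μ := iidLaw ρ)]
      refine lintegral_congr_ae ?_
      filter_upwards [h.len_pos] with v hv
      exact Set.indicator_of_notMem (by exact hv.ne') _
    rw [hzero, hzero, zero_mul]
  · rw [← lintegral_mul_shift ρ t (hf.indicator (hm t)) hg]
    · refine lintegral_congr fun v => ?_
      by_cases hv : T v = t
      · have hv' : v ∈ {v | T v = t} := hv
        rw [Set.indicator_of_mem hv', Set.indicator_of_mem hv']
        change f v * g (fun i => v (T v + i)) = f v * g (fun i => v (t + i))
        rw [hv]
      · have hv' : v ∉ {v | T v = t} := hv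
        rw [Set.indicator_of_notMem hv', Set.indicator_of_notMem hv', zero_mul]
    · have key : ∀ v w : ℕ → ℝ, (∀ i < t, v i = w i) → T v = t →
          {v | T v = t}.indicator f v = {v | T v = t}.indicator f w := by
        intro v w hvw hv
        have hw : T w = t := by
          rw [← hv]
          exact h.len_congr v w (by omega) (by rwa [hv])
        have hv' : v ∈ {v | T v = t} := hv
        have hw' : w ∈ {v | T v = t} := hw
        rw [Set.indicator_of_mem hv', Set.indicator_of_mem hw']
        exact (hfT v w (by omega) (by rwa [hv])).symm
      intro v w hvw
      by_cases hv : T v = t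
      · exact key v w hvw hv
      by_cases hw : T w = t
      · exact (key w v (fun i hi => (hvw i hi).symm) hw).symm
      · rw [Set.indicator_of_notMem (by exact hv), Set.indicator_of_notMem (by exact hw)]

theorem measurePreserving_blockShift (h : IsBlockRule ρ T M) :
    MeasurePreserving (blockShift T) (iidLaw ρ) (iidLaw ρ) := by
  refine ⟨(measurable_blockShift h.measurable_len), Measure.ext_of_lintegral _ fun g hg => ?_⟩
  rw [lintegral_map hg (measurable_blockShift h.measurable_len)]
  simpa using h.lintegral_mul_blockShift (f := 1) measurable_one hg fun _ _ _ _ => rfl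

theorem ae_iterate_len_pos (h : IsBlockRule ρ T M) :
    ∀ᵐ v ∂iidLaw ρ, ∀ k, 0 < T ((blockShift T)^[k] v) :=
  ae_all_iff.2 fun k =>
    (h.measurePreserving_blockShift.iterate k).quasiMeasurePreserving.ae h.len_pos

theorem measurable_iterate (h : IsBlockRule ρ T M) (k : ℕ) : Measurable ((blockShift T)^[k]) :=
  (h.measurePreserving_blockShift.iterate k).measurable

theorem measurable_blockSeq (h : IsBlockRule ρ T M) : Measurable (blockSeq T M) :=
  measurable_pi_lambda _ fun k => h.measurable_mem.comp (h.measurable_iterate k)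

theorem measurable_blockStart (h : IsBlockRule ρ T M) (k : ℕ) :
    Measurable fun v => blockStart T v k :=
  Finset.measurable_sum _ fun i _ => h.measurable_len.comp (h.measurable_iterate i)

/-- What follows the first `k` blocks is independent of the numbers attached to them. -/
theorem lintegral_blockSeq_mul (h : IsBlockRule ρ T M) {g : (ℕ → ℝ) → ℝ≥0∞} (hg : Measurable g)
    (k : ℕ) {φ : (ℕ → ℕ) → ℝ≥0∞} (hφ : Measurable φ)
    (hφk : ∀ x y : ℕ → ℕ, (∀ i < k, x i = y i) → φ x = φ y) :
    ∫⁻ v, φ (blockSeq T M v) * g ((blockShift T)^[k] v) ∂iidLaw ρ =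
      (∫⁻ v, φ (blockSeq T M v) ∂iidLaw ρ) * ∫⁻ v, g v ∂iidLaw ρ := by
  induction k generalizing φ with
  | zero =>
    have : ∀ x, φ x = φ 0 := fun x => hφk _ _ fun i hi => absurd hi (Nat.not_lt_zero i)
    simp only [this, Function.iterate_zero_apply]
    rw [lintegral_const_mul _ hg]
    simp
  | succ k ih =>
    -- Both integrals are decomposed according to the number of the first block.
    let ψ : ℕ → (ℕ → ℕ) → ℝ≥0∞ := fun m x => φ fun i => Nat.casesOn i m x
    have hcons : ∀ m, Measurable fun (x : ℕ → ℕ) (i : ℕ) => (Nat.casesOn i m x : ℕ) := by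
      intro m
      refine measurable_pi_lambda _ fun i => ?_
      cases i with
      | zero => exact measurable_const
      | succ i => exact measurable_pi_apply i
    have hψ : ∀ m, Measurable (ψ m) := fun m => hφ.comp (hcons m)
    have hψk : ∀ m, ∀ x y : ℕ → ℕ, (∀ i < k, x i = y i) → ψ m x = ψ m y := by
      intro m x y hxy
      refine hφk _ _ fun i hi => ?_
      cases i with
      | zero => rfl
      | succ i => exact hxy i (by omega)
    have hseq : ∀ v, φ (blockSeq T M v) =
        ∑' m, {v | M v = m}.indicator 1 v * ψ m (blockSeq T M (blockShift T v)) := by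
      intro v
      rw [tsum_eq_single (M v)]
      · rw [Set.indicator_of_mem (by exact rfl), Pi.one_apply, one_mul]
        refine congrArg φ (funext fun i => ?_)
        cases i with
        | zero => rfl
        | succ i => rfl
      · intro m hm
        rw [Set.indicator_of_notMem (by exact fun h => hm (Eq.symm h)), zero_mul]
    have hmeas : ∀ m, Measurable ({v | M v = m}.indicator (1 : (ℕ → ℝ) → ℝ≥0∞)) := fun m =>
      measurable_one.indicator (h.measurable_mem (measurableSet_singleton m))
    have hadapt : ∀ m (v w : ℕ → ℝ), 0 < T v → (∀ i < T v, v i = w i) →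
        {v | M v = m}.indicator (1 : (ℕ → ℝ) → ℝ≥0∞) w = {v | M v = m}.indicator 1 v := by
      intro m v w hv hvw
      simp only [Set.indicator, Set.mem_ofPred_eq, h.mem_congr v w hv hvw, Pi.one_apply]
    simp only [hseq, ← ENNReal.tsum_mul_right]
    rw [lintegral_tsum fun m => ?_, lintegral_tsum fun m => ?_, ← ENNReal.tsum_mul_right]
    · refine tsum_congr fun m => ?_
      have h1 := h.lintegral_mul_blockShift (hmeas m)
        (((hψ m).comp h.measurable_blockSeq).mul (hg.comp (h.measurable_iterate k))) (hadapt m)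
      have h2 := h.lintegral_mul_blockShift (hmeas m) ((hψ m).comp h.measurable_blockSeq) (hadapt m)
      simp only [Pi.mul_apply, Function.comp_apply] at h1 h2
      rw [h2, mul_assoc, ← ih (hψ m) (hψk m), ← h1]
      simp only [mul_assoc, Function.iterate_succ_apply]
    · exact ((hmeas m).mul (((hψ m).comp h.measurable_blockSeq).comp
        (measurable_blockShift h.measurable_len))).aemeasurable
    · exact (((hmeas m).mul (((hψ m).comp h.measurable_blockSeq).comp
        (measurable_blockShift h.measurable_len))).mul (hg.comp (h.measurable_iterate (k + 1)))).aemeasurable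

/-- The moment generating function of the total length of the first `k` blocks. -/
theorem lintegral_pow_blockStart (h : IsBlockRule ρ T M) (s : ℝ≥0∞) (k : ℕ) :
    ∫⁻ v, s ^ blockStart T v k ∂iidLaw ρ = (∫⁻ v, s ^ T v ∂iidLaw ρ) ^ k := by
  induction k with
  | zero => simp [blockStart]
  | succ k ih =>
    have hpow : Measurable fun n : ℕ => s ^ n := measurable_of_countable _
    have hsucc : ∀ v, blockStart T v (k + 1) = T v + blockStart T (blockShift T v) k := by
      intro v
      rw [blockStart, Finset.sum_range_succ', add_comm]
      rfl
    have := h.lintegral_mul_blockShift (f := fun v => s ^ T v)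
      (g := fun v => s ^ blockStart T v k) (hpow.comp h.measurable_len)
      (hpow.comp (h.measurable_blockStart k)) fun v w hv hvw => by
        simp only [h.len_congr v w hv hvw]
    simp only [hsucc, pow_add]
    rw [this, ih, pow_one, mul_comm]

end IsBlockRule

end Regeneration

/-! ### Renewal sequences -/

section Renewal

variable {p u : ℕ → ℝ}

/-- The identity of a renewal process whose lifetime is greater than `w` with probability
`p₀ ⋯ p_{w-1}`; `uₙ` is the probability of a renewal at time `n`. -/
def IsRenewal (p u : ℕ → ℝ) : Prop :=
  ∀ n, ∑ w ∈ Finset.range (n + 1), (∏ j ∈ Finset.range w, p j) * u (n - w) = 1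

theorem IsRenewal.apply_mul_sum_le (h : IsRenewal p u) (hp : ∀ j, 0 ≤ p j) (hu : Antitone u)
    (n : ℕ) : u n * ∑ w ∈ Finset.range (n + 1), ∏ j ∈ Finset.range w, p j ≤ 1 := by
  rw [← h n, Finset.mul_sum]
  refine Finset.sum_le_sum fun w _ => ?_
  rw [mul_comm]
  exact mul_le_mul_of_nonneg_left (hu (Nat.sub_le n w)) (Finset.prod_nonneg fun j _ => hp j)

/-- The factors `a j` may be negative for finitely many `j`, so that only a comparison up to a
constant is available. -/
theorem exists_abs_prod_le {a : ℕ → ℝ} (hp : ∀ j, 0 < p j) (hap : ∀ᶠ j in atTop, |a j| ≤ p j) :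
    ∃ C > 0, ∀ k, |∏ j ∈ Finset.range k, a j| ≤ C * ∏ j ∈ Finset.range k, p j := by
  obtain ⟨m, hm⟩ := eventually_atTop.1 hap
  have hpos : ∀ k, 0 < ∏ j ∈ Finset.range k, p j := fun k => Finset.prod_pos fun j _ => hp j
  set r : ℕ → ℝ := fun k => |∏ j ∈ Finset.range k, a j| / ∏ j ∈ Finset.range k, p j with hr
  have hr0 : ∀ k, 0 ≤ r k := fun k => div_nonneg (abs_nonneg _) (hpos k).le
  have hle : ∀ k ≤ m, r k ≤ ∑ i ∈ Finset.range (m + 1), r i := fun k hk =>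
    Finset.single_le_sum (fun i _ => hr0 i) (Finset.mem_range.2 (by omega))
  refine ⟨1 + ∑ i ∈ Finset.range (m + 1), r i,
    add_pos_of_pos_of_nonneg one_pos (Finset.sum_nonneg fun i _ => hr0 i), fun k => ?_⟩
  have hsmall : ∀ k ≤ m, |∏ j ∈ Finset.range k, a j| ≤
      (1 + ∑ i ∈ Finset.range (m + 1), r i) * ∏ j ∈ Finset.range k, p j := by
    intro k hk
    rw [← div_le_iff₀ (hpos k)]
    exact (hle k hk).trans (by linarith)
  rcases le_total k m with hk | hk
  · exact hsmall k hk
  · induction k, hk using Nat.le_induction with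
    | base => exact hsmall m le_rfl
    | succ k hk ih =>
      rw [Finset.prod_range_succ, Finset.prod_range_succ, abs_mul, ← mul_assoc]
      exact mul_le_mul ih (hm k hk) (abs_nonneg _) ((abs_nonneg _).trans ih)

theorem IsRenewal.tendsto_zero (h : IsRenewal p u) (hp : ∀ j, 0 < p j) (hu : Antitone u)
    (hu0 : ∀ n, 0 ≤ u n) {a : ℕ → ℝ} (hap : ∀ᶠ j in atTop, |a j| ≤ p j)
    (ha : Tendsto (fun n : ℕ => ∑ k ∈ Finset.Icc 1 n, ∏ j ∈ Finset.range k, a j) atTop atTop) :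
    Tendsto u atTop (𝓝 0) := by
  obtain ⟨C, hC, hle⟩ := exists_abs_prod_le hp hap
  have hpos : ∀ k, 0 < ∏ j ∈ Finset.range k, p j := fun k => Finset.prod_pos fun j _ => hp j
  have hS : Tendsto (fun n => ∑ w ∈ Finset.range (n + 1), ∏ j ∈ Finset.range w, p j)
      atTop atTop := by
    refine (tendsto_const_mul_atTop_of_pos hC).1 (tendsto_atTop_mono (fun n => ?_) ha)
    rw [Finset.mul_sum]
    refine (Finset.sum_le_sum fun k _ => (le_abs_self _).trans (hle k)).trans ?_
    refine Finset.sum_le_sum_of_subset_of_nonneg (fun k hk => ?_)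
      fun k _ _ => (mul_pos hC (hpos k)).le
    have := Finset.mem_Icc.1 hk
    exact Finset.mem_range.2 (by omega)
  refine squeeze_zero hu0 (fun n => ?_) hS.inv_tendsto_atTop
  rw [Pi.inv_apply, ← one_div, le_div_iff₀ (Finset.sum_pos (fun k _ => hpos k) (by simp))]
  exact h.apply_mul_sum_le (fun j => (hp j).le) hu n

theorem one_sub_sum_le_prod (hp0 : ∀ j, 0 ≤ p j) (hp1 : ∀ j, p j ≤ 1) (m n : ℕ) :
    1 - ∑ j ∈ Finset.range n, (1 - p (m + j)) ≤ ∏ j ∈ Finset.range n, p (m + j) := by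
  induction n with
  | zero => simp
  | succ n ih =>
    rw [Finset.sum_range_succ, Finset.prod_range_succ]
    have h1 : ∏ j ∈ Finset.range n, p (m + j) ≤ 1 :=
      Finset.prod_le_one (fun j _ => hp0 _) fun j _ => hp1 _
    nlinarith [hp1 (m + n), hp0 (m + n)]

theorem exists_pos_le_prod (hp : ∀ j, 0 < p j) (hp1 : ∀ j, p j ≤ 1)
    (hs : Summable fun j => 1 - p j) : ∃ c > 0, ∀ n, c ≤ ∏ j ∈ Finset.range n, p j := by
  obtain ⟨m, hm⟩ : ∃ m, ∑' j, (1 - p (j + m)) < 1 / 2 :=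
    ((tendsto_sum_nat_add fun j => 1 - p j).eventually_lt_const one_half_pos).exists
  have hsm : Summable fun j => 1 - p (m + j) := by
    simpa only [add_comm] using (summable_nat_add_iff m).2 hs
  have hm' : ∑' j, (1 - p (m + j)) < 1 / 2 := by simpa only [add_comm] using hm
  have hpos : ∀ k, 0 < ∏ j ∈ Finset.range k, p j := fun k => Finset.prod_pos fun j _ => hp j
  have hanti : Antitone fun n => ∏ j ∈ Finset.range n, p j := antitone_nat_of_succ_le fun n => by
    rw [Finset.prod_range_succ]
    exact mul_le_of_le_one_right (hpos n).le (hp1 n)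
  refine ⟨(∏ j ∈ Finset.range m, p j) * (1 / 2), mul_pos (hpos m) one_half_pos, fun n => ?_⟩
  refine le_trans ?_ (hanti (Nat.le_add_left n m))
  simp only
  rw [Finset.prod_range_add]
  refine mul_le_mul_of_nonneg_left ?_ (hpos m).le
  have h1 := one_sub_sum_le_prod (fun j => (hp j).le) hp1 m n
  have h2 := hsm.sum_le_tsum (Finset.range n) fun j _ => sub_nonneg.2 (hp1 (m + j))
  linarith

theorem IsRenewal.summable (h : IsRenewal p u) (hp : ∀ j, 0 < p j) (hp1 : ∀ j, p j ≤ 1)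
    (hu0 : ∀ n, 0 ≤ u n) (hs : Summable fun j => 1 - p j) : Summable u := by
  obtain ⟨c, hc, hcp⟩ := exists_pos_le_prod hp hp1 hs
  refine summable_of_sum_range_le (c := 1 / c) hu0 fun n => ?_
  refine (Finset.sum_le_sum_of_subset_of_nonneg (Finset.range_mono n.le_succ)
    fun i _ _ => hu0 i).trans ?_
  rw [le_div_iff₀ hc, ← h n, ← Finset.sum_range_reflect, Finset.sum_mul]
  refine Finset.sum_le_sum fun w _ => ?_
  rw [mul_comm, show n + 1 - 1 - w = n - w by omega]
  exact mul_le_mul_of_nonneg_right (hcp w) (hu0 _)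

/-- The convolution form of the renewal identity. -/
theorem IsRenewal.apply_succ (h : IsRenewal p u) (n : ℕ) : u (n + 1) =
    ∑ w ∈ Finset.range (n + 1), (∏ j ∈ Finset.range w, p j) * (1 - p w) * u (n - w) := by
  have h1 := h (n + 1)
  rw [Finset.sum_range_succ', ← h n] at h1
  simp only [Finset.range_zero, Finset.prod_empty, one_mul, Nat.sub_zero,
    Nat.add_sub_add_right] at h1
  rw [← eq_sub_iff_add_eq', ← Finset.sum_sub_distrib] at h1
  rw [h1]
  refine Finset.sum_congr rfl fun w _ => ?_
  rw [Finset.prod_range_succ]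
  ring

/-- If the lifetime of a transient renewal process has an exponential tail, then the generating
function of the lifetime is less than `1` at some point greater than `1`, and the renewal
probabilities decay exponentially fast. -/
theorem IsRenewal.exists_le_pow (h : IsRenewal p u) (hp : ∀ j, 0 < p j) (hp1 : ∀ j, p j ≤ 1)
    {D d : ℝ} (hd : 0 < d) (hd1 : d < 1) (hD : ∀ j, 1 - p j ≤ D * d ^ j) :
    ∃ q, 0 < q ∧ q < 1 ∧ ∀ n, u n ≤ q ^ n := by
  have hpos : ∀ k, 0 < ∏ j ∈ Finset.range k, p j := fun k => Finset.prod_pos fun j _ => hp j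
  have hle1 : ∀ k, ∏ j ∈ Finset.range k, p j ≤ 1 := fun k =>
    Finset.prod_le_one (fun j _ => (hp j).le) fun j _ => hp1 j
  have hs : Summable fun j => 1 - p j :=
    Summable.of_nonneg_of_le (fun j => sub_nonneg.2 (hp1 j)) hD
      ((summable_geometric_of_lt_one hd.le hd1).mul_left D)
  obtain ⟨c, hc, hcp⟩ := exists_pos_le_prod hp hp1 hs
  set f : ℕ → ℝ := fun w => (∏ j ∈ Finset.range w, p j) * (1 - p w) with hf
  have hf0 : ∀ w, 0 ≤ f w := fun w => mul_nonneg (hpos w).le (sub_nonneg.2 (hp1 w))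
  have hfD : ∀ w, f w ≤ D * d ^ w := fun w =>
    (mul_le_of_le_one_left (sub_nonneg.2 (hp1 w)) (hle1 w)).trans (hD w)
  have hfsum : ∀ n, ∑ w ∈ Finset.range n, f w = 1 - ∏ j ∈ Finset.range n, p j := by
    intro n
    induction n with
    | zero => simp
    | succ n ih => rw [Finset.sum_range_succ, ih, Finset.prod_range_succ, hf]; ring
  have hfsm : Summable f := Summable.of_nonneg_of_le hf0 hfD
    ((summable_geometric_of_lt_one hd.le hd1).mul_left D)
  have hflt : ∑' w, f w < 1 := by
    have : ∑' w, f w ≤ 1 - c := hfsm.tsum_le_of_sum_range_le fun n => by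
      rw [hfsum]
      linarith [hcp n]
    linarith
  -- The generating function is continuous from the right at `1`.
  obtain ⟨s₀, hs₀, hs₀d⟩ : ∃ s₀ > 1, d * s₀ < 1 := by
    refine ⟨(1 + d⁻¹) / 2, ?_, ?_⟩
    · have := (one_lt_inv₀ hd).2 hd1
      linarith
    · have : d * d⁻¹ = 1 := mul_inv_cancel₀ hd.ne'
      nlinarith
  have hbound : Summable fun w => s₀ * D * (d * s₀) ^ w :=
    (summable_geometric_of_lt_one (by positivity) hs₀d).mul_left _
  have hle : ∀ s ∈ Set.Ioo 1 s₀, ∀ w, f w * s ^ (w + 1) ≤ s₀ * D * (d * s₀) ^ w := by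
    intro s hs w
    have hs1 : 0 < s := one_pos.trans hs.1
    calc f w * s ^ (w + 1) ≤ (D * d ^ w) * s₀ ^ (w + 1) :=
          mul_le_mul (hfD w) (pow_le_pow_left₀ hs1.le hs.2.le _) (by positivity)
            ((hf0 w).trans (hfD w))
      _ = _ := by rw [mul_pow]; ring
  have hlim : Tendsto (fun s : ℝ => ∑' w, f w * s ^ (w + 1)) (𝓝[>] 1) (𝓝 (∑' w, f w)) := by
    refine tendsto_tsum_of_dominated_convergence hbound (fun w => ?_) ?_
    · have : Tendsto (fun s : ℝ => f w * s ^ (w + 1)) (𝓝 1) (𝓝 (f w * 1 ^ (w + 1))) :=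
        (Continuous.tendsto (by fun_prop) 1)
      rw [one_pow, mul_one] at this
      exact this.mono_left nhdsWithin_le_nhds
    · filter_upwards [Ioo_mem_nhdsGT hs₀] with s hs w
      have hs1 : 0 < s := one_pos.trans hs.1
      rw [Real.norm_of_nonneg (mul_nonneg (hf0 w) (by positivity))]
      exact hle s hs w
  obtain ⟨s, hs1, hs⟩ := ((hlim.eventually_lt_const hflt).and (Ioo_mem_nhdsGT hs₀)).exists
  have hs0 : 0 < s := one_pos.trans hs.1
  have hsm : Summable fun w => f w * s ^ (w + 1) :=
    Summable.of_nonneg_of_le (fun w => mul_nonneg (hf0 w) (by positivity)) (hle s hs) hbound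
  have key : ∀ n, u n * s ^ n ≤ 1 := by
    intro n
    induction n using Nat.strong_induction_on with
    | _ n ih =>
      cases n with
      | zero =>
        have := h 0
        simp only [zero_add, Finset.range_one, Finset.sum_singleton, Finset.range_zero,
          Finset.prod_empty, one_mul, Nat.sub_zero] at this
        simp [this]
      | succ n =>
        rw [h.apply_succ, Finset.sum_mul]
        refine le_trans (Finset.sum_le_sum fun w hw => ?_) ((hsm.sum_le_tsum (Finset.range (n + 1))
          fun w _ => mul_nonneg (hf0 w) (by positivity)).trans hs1.le)
        have hwn : w < n + 1 := Finset.mem_range.1 hw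
        have e : s ^ (n + 1) = s ^ (w + 1) * s ^ (n - w) := by
          rw [← pow_add]
          congr 1
          omega
        calc (∏ j ∈ Finset.range w, p j) * (1 - p w) * u (n - w) * s ^ (n + 1)
            = f w * s ^ (w + 1) * (u (n - w) * s ^ (n - w)) := by rw [e, hf]; ring
          _ ≤ f w * s ^ (w + 1) * 1 :=
            mul_le_mul_of_nonneg_left (ih (n - w) (by omega))
              (mul_nonneg (hf0 w) (by positivity))
          _ = f w * s ^ (w + 1) := mul_one _
  refine ⟨s⁻¹, inv_pos.2 hs0, inv_lt_one_of_one_lt₀ hs.1, fun n => ?_⟩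
  rw [inv_pow, ← one_div, le_div_iff₀ (pow_pos hs0 n)]
  exact key n

end Renewal

/-! ### Closed sequences of blocks -/

section Closed

/-- None of the first `n` blocks closes the sequence of the blocks before it. -/
def NoClosed (x : ℕ → ℕ) (n : ℕ) : Prop := ∀ r < n, ¬ Closed x r

theorem closed_add_iff {x : ℕ → ℕ} {w : ℕ} (hw : Closed x w) (s : ℕ) :
    Closed x (w + 1 + s) ↔ Closed (fun i => x (w + 1 + i)) s := by
  constructor
  · intro h k hk
    have := h (w + 1 + k) (by omega)
    simp only
    omega
  · intro h k hk
    rcases le_or_gt k w with hkw | hkw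
    · have := hw k hkw
      omega
    · obtain ⟨i, rfl⟩ := Nat.exists_eq_add_of_le (Nat.succ_le_of_lt hkw)
      have := h i (by omega)
      simp only at this
      rw [Nat.succ_eq_add_one]
      omega

theorem closed_succ_iff (x : ℕ → ℕ) (r : ℕ) :
    Closed x (r + 1) ↔ x 0 ≤ r + 1 ∧ Closed (fun i => x (1 + i)) r := by
  constructor
  · intro h
    refine ⟨by simpa using h 0 (by omega), fun k hk => ?_⟩
    have := h (1 + k) (by omega)
    simp only
    omega
  · rintro ⟨h0, h⟩ k hk
    rcases Nat.eq_zero_or_pos k with rfl | hk0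
    · simpa using h0
    · obtain ⟨i, rfl⟩ := Nat.exists_eq_add_of_le hk0
      have := h i (by omega)
      simp only at this
      rw [Nat.succ_eq_add_one, zero_add]
      omega

open Classical in
/-- The decomposition according to the last block, among the first `n`, that closes the sequence
of the blocks before it. -/
theorem noClosed_add_sum (x : ℕ → ℕ) (n : ℕ) :
    (if NoClosed x n then 1 else 0 : ℝ≥0∞) + ∑ w ∈ Finset.range n,
      (if Closed x w then 1 else 0) *
        (if NoClosed (fun i => x (w + 1 + i)) (n - (w + 1)) then 1 else 0) = 1 := by
  by_cases hn : NoClosed x n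
  · rw [if_pos hn, Finset.sum_eq_zero, add_zero]
    intro w hw
    rw [if_neg (hn w (Finset.mem_range.1 hw)), zero_mul]
  · rw [if_neg hn, zero_add]
    simp only [NoClosed] at hn
    push Not at hn
    obtain ⟨r, hr, hcr⟩ := hn
    set m := Nat.findGreatest (Closed x) (n - 1) with hm
    have hcm : Closed x m := Nat.findGreatest_spec (P := Closed x) (by omega) hcr
    have hmn : m ≤ n - 1 := Nat.findGreatest_le _
    have hmax : ∀ s, m < s → s < n → ¬ Closed x s := fun s hs hsn =>
      Nat.findGreatest_is_greatest hs (by omega)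
    rw [Finset.sum_eq_single m]
    · rw [if_pos hcm, if_pos, one_mul]
      intro s hs hc
      exact hmax _ (by omega) (by omega) ((closed_add_iff hcm s).2 hc)
    · intro w hw hwm
      have hwn := Finset.mem_range.1 hw
      by_cases hcw : Closed x w
      · have hlt : w < m := by
          by_contra! h
          exact hmax w (lt_of_le_of_ne h (Ne.symm hwm)) hwn hcw
        obtain ⟨s, hs⟩ := Nat.exists_eq_add_of_le (Nat.succ_le_of_lt hlt)
        rw [hs, Nat.succ_eq_add_one] at hcm
        rw [if_neg (fun h : NoClosed _ _ => h s (by omega) ((closed_add_iff hcw s).1 hcm)),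
          mul_zero]
      · rw [if_neg hcw, zero_mul]
    · intro h
      exact absurd (Finset.mem_range.2 (by omega)) h

theorem closed_congr {x y : ℕ → ℕ} {r : ℕ} (h : ∀ i < r + 1, x i = y i) :
    Closed x r ↔ Closed y r :=
  forall₂_congr fun k hk => by rw [h k (by omega)]

theorem noClosed_congr {x y : ℕ → ℕ} {n : ℕ} (h : ∀ i < n, x i = y i) :
    NoClosed x n ↔ NoClosed y n :=
  forall₂_congr fun r hr => not_congr (closed_congr fun i hi => h i (by omega))

theorem NoClosed.mono {x : ℕ → ℕ} {m n : ℕ} (h : NoClosed x n) (hmn : m ≤ n) : NoClosed x m :=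
  fun r hr => h r (by omega)

theorem measurableSet_closed (r : ℕ) : MeasurableSet {x : ℕ → ℕ | Closed x r} := by
  have : {x : ℕ → ℕ | Closed x r} = ⋂ k, {x | k ≤ r → x k ≤ r - k} := by
    ext x
    simp [Closed]
  rw [this]
  refine MeasurableSet.iInter fun k => ?_
  by_cases hk : k ≤ r
  · simpa [hk] using measurableSet_le (measurable_pi_apply k) measurable_const
  · simp [hk]

theorem measurableSet_noClosed (n : ℕ) : MeasurableSet {x : ℕ → ℕ | NoClosed x n} := by
  have : {x : ℕ → ℕ | NoClosed x n} = ⋂ r, {x | r < n → ¬ Closed x r} := by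
    ext x
    simp [NoClosed]
  rw [this]
  refine MeasurableSet.iInter fun r => ?_
  by_cases hr : r < n
  · simp only [hr, true_imp_iff]
    exact (measurableSet_closed r).compl
  · simp [hr]

end Closed

/-! ### The first closed sequence of blocks -/

section FirstClosed

variable (ρ : Measure ℝ) (T M : (ℕ → ℝ) → ℕ)

/-- The probability that the number attached to a block is at most `m`. -/
def memProb (m : ℕ) : ℝ := (iidLaw ρ).real {v | M v ≤ m}

/-- The probability that none of the first `n` blocks closes the sequence. -/
def openProb (n : ℕ) : ℝ := (iidLaw ρ).real {v | NoClosed (blockSeq T M v) n}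

/-- The total length of the blocks up to the first one that closes the sequence. -/
def totalLen (v : ℕ → ℝ) : ℝ≥0∞ :=
  ∑' k, {v | NoClosed (blockSeq T M v) k}.indicator (fun v => (T ((blockShift T)^[k] v) : ℝ≥0∞)) v

variable {ρ T M}

theorem openProb_nonneg (T M : (ℕ → ℝ) → ℕ) (n : ℕ) : 0 ≤ openProb ρ T M n :=
  measureReal_nonneg

theorem blockSeq_iterate (w : ℕ) (v : ℕ → ℝ) :
    blockSeq T M ((blockShift T)^[w] v) = fun i => blockSeq T M v (w + i) := by
  funext i
  simp only [blockSeq]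
  rw [← Function.iterate_add_apply, add_comm i w]

theorem totalLen_le {v : ℕ → ℝ} {n : ℕ} (h : ¬ NoClosed (blockSeq T M v) n) :
    totalLen T M v ≤ blockStart T v n := by
  rw [totalLen, tsum_eq_sum (s := Finset.range n), blockStart, Nat.cast_sum]
  · exact Finset.sum_le_sum fun k _ => Set.indicator_le_self {v | NoClosed (blockSeq T M v) k}
      (fun v => (T ((blockShift T)^[k] v) : ℝ≥0∞)) v
  · intro k hk
    have hnk : n ≤ k := by simpa using hk
    have hv : v ∉ {v | NoClosed (blockSeq T M v) k} := fun hv => h (NoClosed.mono hv hnk)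
    exact Set.indicator_of_notMem hv _

theorem exists_closed_le_totalLen {v : ℕ → ℝ} (h : ∃ r, Closed (blockSeq T M v) r) :
    ∃ r, Closed (blockSeq T M v) r ∧ (blockStart T v (r + 1) : ℝ≥0∞) ≤ totalLen T M v := by
  classical
  refine ⟨Nat.find h, Nat.find_spec h, ?_⟩
  rw [blockStart, Nat.cast_sum]
  refine le_trans (le_of_eq (Finset.sum_congr rfl fun k hk => ?_))
    (ENNReal.sum_le_tsum (Finset.range (Nat.find h + 1)))
  have hv : v ∈ {v | NoClosed (blockSeq T M v) k} := fun r hr =>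
    Nat.find_min h (by have := Finset.mem_range.1 hk; omega)
  exact (Set.indicator_of_mem hv fun v => (T ((blockShift T)^[k] v) : ℝ≥0∞)).symm

theorem totalLen_eq_top {v : ℕ → ℝ} (hpos : ∀ k, 0 < T ((blockShift T)^[k] v))
    (h : ¬ ∃ r, Closed (blockSeq T M v) r) : totalLen T M v = ⊤ := by
  refine top_unique ((ENNReal.tsum_const_eq_top_of_ne_zero (α := ℕ) one_ne_zero).ge.trans ?_)
  refine ENNReal.tsum_le_tsum fun k => ?_
  have hv : v ∈ {v | NoClosed (blockSeq T M v) k} := fun r _ hr => h ⟨r, hr⟩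
  rw [Set.indicator_of_mem hv]
  exact_mod_cast hpos k

namespace IsBlockRule

theorem measurableSet_mem_le (h : IsBlockRule ρ T M) (m : ℕ) : MeasurableSet {v | M v ≤ m} :=
  measurableSet_le h.measurable_mem measurable_const

variable [IsProbabilityMeasure ρ]

theorem measurableSet_open (h : IsBlockRule ρ T M) (n : ℕ) :
    MeasurableSet {v | NoClosed (blockSeq T M v) n} :=
  h.measurable_blockSeq (measurableSet_noClosed n)

theorem measurableSet_closed_blockSeq (h : IsBlockRule ρ T M) (r : ℕ) :
    MeasurableSet {v | Closed (blockSeq T M v) r} :=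
  h.measurable_blockSeq (measurableSet_closed r)

theorem measure_closed (h : IsBlockRule ρ T M) (r : ℕ) :
    iidLaw ρ {v | Closed (blockSeq T M v) r} =
      ∏ j ∈ Finset.range (r + 1), iidLaw ρ {v | M v ≤ j} := by
  induction r with
  | zero =>
    have : ∀ v, Closed (blockSeq T M v) 0 ↔ M v ≤ 0 := fun v =>
      ⟨fun h => h 0 le_rfl, fun h k hk => by rw [Nat.le_zero.1 hk]; exact h⟩
    simp [this]
  | succ r ih =>
    have hm : Measurable ({v | M v ≤ r + 1}.indicator (1 : (ℕ → ℝ) → ℝ≥0∞)) :=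
      measurable_one.indicator (h.measurableSet_mem_le _)
    have hc : MeasurableSet {v | Closed (blockSeq T M v) r} :=
      h.measurableSet_closed_blockSeq r
    have key := h.lintegral_mul_blockShift hm (measurable_one.indicator hc) fun v w hv hvw => by
      simp only [Set.indicator, Set.mem_ofPred_eq, h.mem_congr v w hv hvw, Pi.one_apply]
    rw [lintegral_indicator_one (h.measurableSet_mem_le _), lintegral_indicator_one hc, ih] at key
    rw [Finset.prod_range_succ, mul_comm, ← key,
      ← lintegral_indicator_one (h.measurableSet_closed_blockSeq (r + 1))]
    refine lintegral_congr fun v => ?_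
    have hiff : Closed (blockSeq T M v) (r + 1) ↔
        M v ≤ r + 1 ∧ Closed (blockSeq T M (blockShift T v)) r := by
      have := blockSeq_iterate (T := T) (M := M) 1 v
      rw [Function.iterate_one] at this
      rw [closed_succ_iff, this]
      rfl
    by_cases h1 : M v ≤ r + 1 <;> by_cases h2 : Closed (blockSeq T M (blockShift T v)) r <;>
      simp only [h1, h2, and_self, and_true, and_false, iff_true, iff_false] at hiff <;>
      simp [Set.indicator, hiff, h1, h2]

open Classical in
theorem isRenewal (h : IsBlockRule ρ T M) : IsRenewal (memProb ρ M) (openProb ρ T M) := by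
  intro n
  have hO : ∀ n, ∫⁻ v, (if NoClosed (blockSeq T M v) n then 1 else 0 : ℝ≥0∞) ∂iidLaw ρ =
      iidLaw ρ {v | NoClosed (blockSeq T M v) n} := by
    intro n
    rw [← lintegral_indicator_one (h.measurableSet_open n)]
    rfl
  have hC : ∀ r, ∫⁻ v, (if Closed (blockSeq T M v) r then 1 else 0 : ℝ≥0∞) ∂iidLaw ρ =
      iidLaw ρ {v | Closed (blockSeq T M v) r} := by
    intro r
    rw [← lintegral_indicator_one (h.measurableSet_closed_blockSeq r)]
    rfl
  have mO : ∀ n, Measurable fun v => (if NoClosed (blockSeq T M v) n then 1 else 0 : ℝ≥0∞) :=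
    fun n => Measurable.ite (h.measurableSet_open n) measurable_const measurable_const
  have mC : ∀ r, Measurable fun x : ℕ → ℕ => (if Closed x r then 1 else 0 : ℝ≥0∞) :=
    fun r => Measurable.ite (measurableSet_closed r) measurable_const measurable_const
  have hterm : ∀ w, ∫⁻ v, (if Closed (blockSeq T M v) w then 1 else 0 : ℝ≥0∞) *
      (if NoClosed (fun i => blockSeq T M v (w + 1 + i)) (n - (w + 1)) then 1 else 0) ∂iidLaw ρ =
      (∏ j ∈ Finset.range (w + 1), iidLaw ρ {v | M v ≤ j}) *
        iidLaw ρ {v | NoClosed (blockSeq T M v) (n - (w + 1))} := by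
    intro w
    have := h.lintegral_blockSeq_mul (mO (n - (w + 1))) (w + 1) (mC w) fun x y hxy => by
      simp only [closed_congr hxy]
    rw [hC, hO, h.measure_closed] at this
    simp only [blockSeq_iterate] at this
    exact this
  have hint : iidLaw ρ {v | NoClosed (blockSeq T M v) n} + ∑ w ∈ Finset.range n,
      (∏ j ∈ Finset.range (w + 1), iidLaw ρ {v | M v ≤ j}) *
        iidLaw ρ {v | NoClosed (blockSeq T M v) (n - (w + 1))} = 1 := by
    have := lintegral_congr (μ := iidLaw ρ) fun v => noClosed_add_sum (blockSeq T M v) n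
    rw [lintegral_add_left (mO n), hO, lintegral_finsetSum, lintegral_one, measure_univ] at this
    · simpa only [hterm] using this
    · intro w _
      have e := mO (n - (w + 1))
      refine ((mC w).comp h.measurable_blockSeq).mul ?_
      simpa only [Function.comp_def, blockSeq_iterate] using e.comp (h.measurable_iterate (w + 1))
  have hreal := congrArg ENNReal.toReal hint
  rw [ENNReal.toReal_add (measure_ne_top _ _) (ENNReal.sum_ne_top.2 fun w _ =>
    ENNReal.mul_ne_top (ENNReal.prod_ne_top fun j _ => measure_ne_top _ _) (measure_ne_top _ _)),
    ENNReal.toReal_sum fun w _ =>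
      ENNReal.mul_ne_top (ENNReal.prod_ne_top fun j _ => measure_ne_top _ _) (measure_ne_top _ _)]
    at hreal
  simp only [ENNReal.toReal_mul, ENNReal.toReal_prod, ENNReal.toReal_one] at hreal
  rw [Finset.sum_range_succ', add_comm]
  simpa [memProb, openProb, Measure.real] using hreal

theorem antitone_openProb (T M : (ℕ → ℝ) → ℕ) : Antitone (openProb ρ T M) := fun _ _ hmn =>
  measureReal_mono fun _ hv => NoClosed.mono hv hmn

theorem lintegral_totalLen (h : IsBlockRule ρ T M) : ∫⁻ v, totalLen T M v ∂iidLaw ρ =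
    (∑' k, iidLaw ρ {v | NoClosed (blockSeq T M v) k}) * ∫⁻ v, T v ∂iidLaw ρ := by
  have hT : Measurable fun v => (T v : ℝ≥0∞) :=
    (measurable_of_countable fun n : ℕ => (n : ℝ≥0∞)).comp h.measurable_len
  simp only [totalLen]
  have hmeas : ∀ k, AEMeasurable ({v | NoClosed (blockSeq T M v) k}.indicator
      fun v => (T ((blockShift T)^[k] v) : ℝ≥0∞)) (iidLaw ρ) := fun k =>
    ((hT.comp (h.measurable_iterate k)).indicator (h.measurableSet_open k)).aemeasurable
  rw [lintegral_tsum hmeas, ← ENNReal.tsum_mul_right]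
  refine tsum_congr fun k => ?_
  have := h.lintegral_blockSeq_mul hT k
    (measurable_one.indicator (measurableSet_noClosed k)) fun x y hxy => by
      by_cases hx : NoClosed x k
      · simp [Set.indicator, hx, (noClosed_congr hxy).1 hx]
      · simp [Set.indicator, hx, mt (noClosed_congr hxy).2 hx]
  rw [← lintegral_indicator_one (h.measurableSet_open k)]
  refine Eq.trans (lintegral_congr fun v => ?_) this
  by_cases hv : NoClosed (blockSeq T M v) k
  · simp [Set.indicator, hv]
  · simp [Set.indicator, hv]

theorem tsum_measure_open_ne_top (hs : Summable (openProb ρ T M)) :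
    ∑' k, iidLaw ρ {v | NoClosed (blockSeq T M v) k} ≠ ⊤ := by
  have : ∀ k, iidLaw ρ {v | NoClosed (blockSeq T M v) k} = ENNReal.ofReal (openProb ρ T M k) :=
    fun k => (ENNReal.ofReal_toReal (measure_ne_top _ _)).symm
  simp only [this]
  exact hs.tsum_ofReal_ne_top

theorem ae_exists_closed (hlim : Tendsto (openProb ρ T M) atTop (𝓝 0)) :
    ∀ᵐ v ∂iidLaw ρ, ∃ r, Closed (blockSeq T M v) r := by
  have hle : ∀ n, (iidLaw ρ).real {v | ¬ ∃ r, Closed (blockSeq T M v) r} ≤ openProb ρ T M n :=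
    fun n => measureReal_mono fun v hv r _ hr => hv ⟨r, hr⟩
  have h0 := le_antisymm (ge_of_tendsto' hlim hle) measureReal_nonneg
  exact (measureReal_eq_zero_iff).1 h0

/-- The tail of the total length, cut at `m` blocks. -/
theorem measure_le_totalLen (h : IsBlockRule ρ T M) (n m : ℕ) {s : ℝ≥0∞} (hs : 1 ≤ s)
    (hs' : s ≠ ⊤) :
    iidLaw ρ {v | (n : ℝ≥0∞) ≤ totalLen T M v} ≤ ENNReal.ofReal (openProb ρ T M m) +
      (∫⁻ v, s ^ T v ∂iidLaw ρ) ^ m / s ^ n := by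
  have hsub : {v | (n : ℝ≥0∞) ≤ totalLen T M v} ⊆
      {v | NoClosed (blockSeq T M v) m} ∪ {v | s ^ n ≤ s ^ blockStart T v m} := by
    intro v hv
    by_cases hno : NoClosed (blockSeq T M v) m
    · exact Or.inl hno
    · have h1 : (n : ℝ≥0∞) ≤ blockStart T v m := le_trans hv (totalLen_le hno)
      exact Or.inr (pow_le_pow_right₀ hs (by exact_mod_cast h1))
  refine (measure_mono hsub).trans ((measure_union_le _ _).trans (add_le_add ?_ ?_))
  · rw [openProb, ofReal_measureReal]
  · rw [← h.lintegral_pow_blockStart]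
    exact meas_ge_le_lintegral_div ((measurable_of_countable fun n : ℕ => s ^ n).comp
      (h.measurable_blockStart m)).aemeasurable (ENNReal.pow_pos (one_pos.trans_le hs) n).ne'
      (ENNReal.pow_ne_top hs')

end IsBlockRule

end FirstClosed

/-! ### Good blocks of uniform variables -/

section GoodBlockRule

/-- The uniform law on `[0,1)`. -/
abbrev unifLaw : Measure ℝ := volume.restrict (Set.Ico (0 : ℝ) 1)

instance isProbabilityMeasure_unifLaw : IsProbabilityMeasure unifLaw := ⟨by simp [unifLaw]⟩

theorem measurable_sInf_nat {α : Type*} [MeasurableSpace α] {q : ℕ → α → Prop}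
    (hq : ∀ k, MeasurableSet {x | q k x}) : Measurable fun x => sInf {k | q k x} := by
  classical
  refine measurable_to_countable' fun n => ?_
  have hlt : MeasurableSet {x | ∀ j, j < n → ¬ q j x} := by
    have : {x | ∀ j, j < n → ¬ q j x} = ⋂ j, {x | j < n → ¬ q j x} := by ext; simp
    rw [this]
    refine MeasurableSet.iInter fun j => ?_
    by_cases hj : j < n
    · simp only [hj, true_imp_iff]
      exact (hq j).compl
    · simp [hj]
  have hall : MeasurableSet {x | ∀ j, ¬ q j x} := by
    have : {x | ∀ j, ¬ q j x} = ⋂ j, {x | q j x}ᶜ := by ext; simp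
    rw [this]
    exact MeasurableSet.iInter fun j => (hq j).compl
  have hmin : MeasurableSet {x | q n x ∧ ∀ j, j < n → ¬ q j x} := (hq n).inter hlt
  have hnone : MeasurableSet {x | n = 0 ∧ ∀ j, ¬ q j x} := (MeasurableSet.const (n = 0)).inter hall
  have hset : (fun x => sInf {k | q k x}) ⁻¹' {n} =
      {x | q n x ∧ ∀ j, j < n → ¬ q j x} ∪ {x | n = 0 ∧ ∀ j, ¬ q j x} := by
    ext x
    simp only [Set.mem_preimage, Set.mem_singleton_iff, Set.mem_union, Set.mem_ofPred_eq]
    constructor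
    · intro h
      by_cases hex : ∃ k, q k x
      · left
        have hmem : sInf {k | q k x} ∈ {k | q k x} := Nat.sInf_mem hex
        rw [h] at hmem
        exact ⟨hmem, fun j hj => Nat.notMem_of_lt_sInf (s := {k | q k x}) (h.symm ▸ hj)⟩
      · right
        push Not at hex
        refine ⟨?_, hex⟩
        rw [← h]
        have : {k | q k x} = ∅ := Set.eq_empty_of_forall_notMem hex
        rw [this, Nat.sInf_empty]
    · rintro (⟨hn, hlt⟩ | ⟨rfl, hno⟩)
      · refine le_antisymm (Nat.sInf_le hn) ?_
        by_contra! hc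
        exact hlt _ hc (Nat.sInf_mem (s := {k | q k x}) ⟨n, hn⟩)
      · have : {k | q k x} = ∅ := Set.eq_empty_of_forall_notMem hno
        rw [this, Nat.sInf_empty]
  rw [hset]
  exact hmin.union hnone

section Rank

variable {A : Type u} (P : TransitionKernel A) (τ : Set (PastString A))

theorem measurable_rank : Measurable (rank P τ) :=
  measurable_sInf_nat fun _ => measurableSet_Iio

theorem memRate_nonneg (k : ℕ) : 0 ≤ memRate P τ k := by
  rw [memRate]
  split_ifs
  exacts [alphaNeg_nonneg P, alphaUnif_nonneg P τ k]

theorem memRate_le_one [Nonempty A] (k : ℕ) : memRate P τ k ≤ 1 := by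
  rw [memRate]
  split_ifs
  exacts [alphaNeg_le_one P, alphaUnif_le_one P τ k]

theorem unifLaw_memRate_le [Nonempty A] (k : ℕ) :
    unifLaw {t | memRate P τ k ≤ t} = ENNReal.ofReal (1 - memRate P τ k) := by
  have : {t | memRate P τ k ≤ t} ∩ Set.Ico 0 1 = Set.Ico (memRate P τ k) 1 := by
    ext t
    have := memRate_nonneg P τ k
    simp only [Set.mem_inter_iff, Set.mem_ofPred_eq, Set.mem_Ico]
    exact ⟨fun h => ⟨h.1, h.2.2⟩, fun h => ⟨h.1, this.trans h.1, h.2⟩⟩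
  rw [unifLaw, Measure.restrict_apply (measurableSet_le measurable_const measurable_id'), this,
    Real.volume_Ico]

end Rank

variable {A : Type u} [Encodable A] (P : TransitionKernel A) (τ : Set (PastString A))

theorem measurableSet_symbY [Nonempty A] (o : Option A) : MeasurableSet {t | symbY P t = o} := by
  have hsome : ∀ a, MeasurableSet {t | symbY P t = some a} := fun a => by
    simp only [symbY_eq_some_iff, inSymbInterval_iff]
    exact measurableSet_Ico
  cases o with
  | some a => exact hsome a
  | none =>
    have : {t | symbY P t = none} = (⋃ a, {t | symbY P t = some a})ᶜ := by
      ext t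
      simp [Option.eq_none_iff_forall_ne_some]
    rw [this]
    exact (MeasurableSet.iUnion hsome).compl

/-- A set of sequences is measurable if it only depends on finitely many of the symbols `Y`. -/
theorem measurableSet_of_symbY [Nonempty A] {D : Set (ℕ → ℝ)} {m : ℕ}
    (hD : ∀ v w : ℕ → ℝ, (∀ i < m, symbY P (v i) = symbY P (w i)) → v ∈ D → w ∈ D) :
    MeasurableSet D := by
  let Φ : (ℕ → ℝ) → Fin m → Option A := fun v i => symbY P (v i)
  have hfib : ∀ y, MeasurableSet (Φ ⁻¹' {y}) := by
    intro y
    have : Φ ⁻¹' {y} = ⋂ i : Fin m, (fun v : ℕ → ℝ => v i) ⁻¹' {t | symbY P t = y i} := by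
      ext v
      simp [Φ, funext_iff]
    rw [this]
    exact MeasurableSet.iInter fun i => measurable_pi_apply _ (measurableSet_symbY P (y i))
  have hDΦ : D = ⋃ y ∈ Φ '' D, Φ ⁻¹' {y} := by
    ext w
    simp only [Set.mem_iUnion, Set.mem_preimage, Set.mem_singleton_iff, exists_prop,
      exists_eq_right', Set.mem_image]
    refine ⟨fun hw => ⟨w, hw, rfl⟩, ?_⟩
    rintro ⟨v, hv, hvw⟩
    exact hD v w (fun i hi => congrFun hvw ⟨i, hi⟩) hv
  rw [hDΦ]
  exact MeasurableSet.biUnion (Set.to_countable _) fun y _ => hfib y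

variable {P τ}

theorem maxLen_le_congr (hτ : IsContextTree τ) {v w : ℕ → ℝ} {m : ℕ}
    (hvw : ∀ i < m, symbY P (v i) = symbY P (w i)) (h : maxLen P τ v ≤ m) : maxLen P τ w ≤ m := by
  refine iSup_le fun a => ?_
  have ha := (le_iSup (fun a : ℕ → A =>
    (context τ fun k => (symbY P (v k)).getD (a k)).len) a).trans h
  rw [context_congr hτ (y := fun k => (symbY P (w k)).getD (a k)) ha fun i hi => by rw [hvw i hi]]
  exact ha

theorem goodDepth_congr (hτ : IsContextTree τ) {v w : ℕ → ℝ} {t : ℕ}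
    (hvw : ∀ i < t, symbY P (v i) = symbY P (w i)) (h : GoodDepth P τ v t) : GoodDepth P τ w t := by
  intro j hj
  rw [← hvw j hj]
  exact (h j hj).imp_right fun h => maxLen_le_congr hτ (fun i hi => hvw _ (by omega)) h

theorem measurable_blockLen [Nonempty A] (hτ : IsContextTree τ) : Measurable (blockLen P τ) :=
  measurable_sInf_nat fun t => (MeasurableSet.const (0 < t)).inter
    (measurableSet_of_symbY P fun _ _ hvw h => goodDepth_congr hτ hvw h)

theorem measurable_blockRank [Nonempty A] (hτ : IsContextTree τ) :
    Measurable (blockRank P τ) := by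
  have hsup : ∀ n, Measurable fun v : ℕ → ℝ => (Finset.range n).sup fun j => rank P τ (v j) := by
    intro n
    induction n with
    | zero => simp
    | succ n ih =>
      simp only [Finset.range_add_one, Finset.sup_insert]
      exact ((measurable_rank P τ).comp (measurable_pi_apply n)).sup ih
  have : blockRank P τ = (fun q : (ℕ → ℝ) × ℕ =>
      (Finset.range q.2).sup fun j => rank P τ (q.1 j)) ∘ fun v => (v, blockLen P τ v) := rfl
  rw [this]
  exact (measurable_from_prod_countable_left hsup).comp
    (measurable_id.prodMk (measurable_blockLen hτ))

theorem blockLen_congr (hτ : IsContextTree τ) {v w : ℕ → ℝ} (hv : 0 < blockLen P τ v)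
    (hvw : ∀ i < blockLen P τ v, v i = w i) : blockLen P τ w = blockLen P τ v := by
  have hle : blockLen P τ w ≤ blockLen P τ v := Nat.sInf_le
    ⟨hv, goodDepth_congr hτ (fun i hi => by rw [hvw i hi]) (goodDepth_blockLen hv)⟩
  refine le_antisymm hle ?_
  have hmem : blockLen P τ w ∈ {t | 0 < t ∧ GoodDepth P τ w t} := Nat.sInf_mem
    ⟨_, hv, goodDepth_congr hτ (fun i hi => by rw [hvw i hi]) (goodDepth_blockLen hv)⟩
  exact Nat.sInf_le ⟨hmem.1, goodDepth_congr hτ (fun i hi => by rw [hvw i (by omega)]) hmem.2⟩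

theorem blockRank_congr (hτ : IsContextTree τ) {v w : ℕ → ℝ} (hv : 0 < blockLen P τ v)
    (hvw : ∀ i < blockLen P τ v, v i = w i) : blockRank P τ w = blockRank P τ v := by
  rw [blockRank, blockRank, blockLen_congr hτ hv hvw]
  exact Finset.sup_congr rfl fun j hj => by rw [hvw j (Finset.mem_range.1 hj)]

theorem measurable_blockLenE [Nonempty A] (hτ : IsContextTree τ) : Measurable (blockLenE P τ) :=
  (measurable_of_countable fun n : ℕ => if n = 0 then (⊤ : ℝ≥0∞) else n).comp
    (measurable_blockLen hτ)

theorem ae_blockLen_pos [Nonempty A] (hτ : IsContextTree τ) {ν : Measure (ℕ → ℝ)}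
    (hE : ∫⁻ v, blockLenE P τ v ∂ν ≠ ⊤) : ∀ᵐ v ∂ν, 0 < blockLen P τ v := by
  filter_upwards [ae_lt_top (measurable_blockLenE hτ) hE] with v hv
  refine Nat.pos_of_ne_zero fun h => ?_
  rw [blockLenE, if_pos h] at hv
  exact lt_irrefl _ hv

theorem lintegral_blockLen [Nonempty A] (hτ : IsContextTree τ) {ν : Measure (ℕ → ℝ)}
    (hE : ∫⁻ v, blockLenE P τ v ∂ν ≠ ⊤) :
    ∫⁻ v, (blockLen P τ v : ℝ≥0∞) ∂ν = ∫⁻ v, blockLenE P τ v ∂ν := by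
  refine lintegral_congr_ae ?_
  filter_upwards [ae_blockLen_pos hτ hE] with v hv
  rw [blockLenE, if_neg hv.ne']

theorem isBlockRule_blockLen [Nonempty A] (hτ : IsContextTree τ)
    (hE : ∫⁻ v, blockLenE P τ v ∂iidLaw unifLaw ≠ ⊤) :
    IsBlockRule unifLaw (blockLen P τ) (blockRank P τ) where
  measurable_len := measurable_blockLen hτ
  measurable_mem := measurable_blockRank hτ
  len_pos := ae_blockLen_pos hτ hE
  len_congr _ _ := blockLen_congr hτ
  mem_congr _ _ := blockRank_congr hτ

/-- The expected number of entries of rank greater than `m` in a good block is the expected length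
of the block times the probability of such a rank, because the event that the block is longer than
`j` is determined by the first `j` entries. -/
theorem measure_lt_blockRank_le [Nonempty A] (hτ : IsContextTree τ)
    (hE : ∫⁻ v, blockLenE P τ v ∂iidLaw unifLaw ≠ ⊤) (m : ℕ) :
    iidLaw unifLaw {v | m < blockRank P τ v} ≤
      (∫⁻ v, blockLenE P τ v ∂iidLaw unifLaw) * ENNReal.ofReal (1 - memRate P τ m) := by
  set ν := iidLaw unifLaw with hν
  have hmT := measurable_blockLen (P := P) hτ
  set L : ℕ → Set (ℕ → ℝ) := fun j => {v | ¬ (0 < blockLen P τ v ∧ blockLen P τ v ≤ j)} with hL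
  have hLm : ∀ j, MeasurableSet (L j) := fun j =>
    ((measurableSet_lt measurable_const hmT).inter (measurableSet_le hmT measurable_const)).compl
  set B : Set (ℕ → ℝ) := {v | memRate P τ m ≤ v 0} with hB
  have hBm : MeasurableSet B := measurableSet_le measurable_const (measurable_pi_apply 0)
  have hνB : ν B = ENNReal.ofReal (1 - memRate P τ m) := by
    rw [← unifLaw_memRate_le, ← (measurePreserving_eval_infinitePi (fun _ : ℕ => unifLaw)
      0).measure_preimage (measurableSet_le measurable_const measurable_id').nullMeasurableSet]
    rfl
  have hind : ∀ j, ∫⁻ v, (L j).indicator 1 v * B.indicator 1 (fun i => v (j + i)) ∂ν =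
      ν (L j) * ν B := by
    intro j
    rw [hν, lintegral_mul_shift unifLaw j (measurable_one.indicator (hLm j))
      (measurable_one.indicator hBm), lintegral_indicator_one (hLm j), lintegral_indicator_one hBm]
    have hsub : ∀ v w : ℕ → ℝ, (∀ i < j, v i = w i) → v ∉ L j → w ∉ L j := by
      intro v w hvw hv
      simp only [hL, Set.mem_ofPred_eq, not_not] at hv ⊢
      rwa [blockLen_congr hτ hv.1 fun i hi => hvw i (hi.trans_le hv.2)]
    intro v w hvw
    by_cases hv : v ∈ L j
    · have hw : w ∈ L j := by
        by_contra hw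
        exact hsub w v (fun i hi => (hvw i hi).symm) hw hv
      rw [Set.indicator_of_mem hv, Set.indicator_of_mem hw]
      rfl
    · rw [Set.indicator_of_notMem hv, Set.indicator_of_notMem (hsub v w hvw hv)]
  have hlen : ∑' j, ν (L j) = ∫⁻ v, blockLenE P τ v ∂ν := by
    have h1 : ∀ j, ν (L j) = ∫⁻ v, (L j).indicator 1 v ∂ν := fun j =>
      (lintegral_indicator_one (hLm j)).symm
    simp only [h1]
    rw [← lintegral_tsum fun j => (measurable_one.indicator (hLm j)).aemeasurable]
    refine lintegral_congr_ae ?_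
    filter_upwards [ae_blockLen_pos hτ hE] with v hv
    rw [blockLenE, if_neg hv.ne', tsum_eq_sum (s := Finset.range (blockLen P τ v))]
    · rw [Finset.sum_congr rfl fun j hj => Set.indicator_of_mem (f := (1 : (ℕ → ℝ) → ℝ≥0∞))
        (show v ∈ L j from fun h => absurd h.2 (not_le.2 (Finset.mem_range.1 hj)))]
      simp
    · intro j hj
      have hjT : blockLen P τ v ≤ j := by simpa using hj
      exact Set.indicator_of_notMem (f := (1 : (ℕ → ℝ) → ℝ≥0∞))
        (show v ∉ L j from fun h => h ⟨hv, hjT⟩)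
  rw [← hlen, ← hνB, ← ENNReal.tsum_mul_right]
  simp only [← hind]
  rw [← lintegral_tsum fun j => ?_, ← lintegral_indicator_one
    (measurableSet_lt measurable_const (measurable_blockRank hτ))]
  · refine lintegral_mono fun v => ?_
    by_cases hv : m < blockRank P τ v
    · obtain ⟨j, hj, hjm⟩ := (Finset.lt_sup_iff (s := Finset.range (blockLen P τ v))).1 hv
      have hjT : j < blockLen P τ v := Finset.mem_range.1 hj
      have hjL : v ∈ L j := fun h => absurd h.2 (not_le.2 hjT)
      have hjB : (fun i => v (j + i)) ∈ B := by
        by_contra hb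
        exact absurd (rank_le (not_le.1 hb)) (not_le.2 hjm)
      refine le_trans ?_ (ENNReal.le_tsum j)
      rw [Set.indicator_of_mem hjL, Set.indicator_of_mem hjB]
      simpa using Set.indicator_le_self {v | m < blockRank P τ v} (1 : (ℕ → ℝ) → ℝ≥0∞) v
    · rw [Set.indicator_of_notMem (by exact hv)]
      exact zero_le
  · have hsh : Measurable fun (v : ℕ → ℝ) (i : ℕ) => v (j + i) := by fun_prop
    exact ((measurable_one.indicator (hLm j)).mul
      ((measurable_one.indicator hBm).comp hsh)).aemeasurable

theorem one_sub_le_memProb [Nonempty A] (hτ : IsContextTree τ)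
    (hE : ∫⁻ v, blockLenE P τ v ∂iidLaw unifLaw ≠ ⊤) (m : ℕ) :
    1 - (∫⁻ v, blockLenE P τ v ∂iidLaw unifLaw).toReal * (1 - memRate P τ m) ≤
      memProb unifLaw (blockRank P τ) m := by
  have h1 := ENNReal.toReal_mono (ENNReal.mul_ne_top hE ENNReal.ofReal_ne_top)
    (measure_lt_blockRank_le hτ hE m)
  rw [ENNReal.toReal_mul, ENNReal.toReal_ofReal (sub_nonneg.2 (memRate_le_one P τ m))] at h1
  have h2 : {v | m < blockRank P τ v} = {v | blockRank P τ v ≤ m}ᶜ := by ext; simp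
  have h3 := probReal_compl_eq_one_sub (μ := iidLaw unifLaw)
    ((isBlockRule_blockLen hτ hE).measurableSet_mem_le m)
  rw [h2] at h1
  change (iidLaw unifLaw).real _ ≤ _ at h1
  rw [h3] at h1
  rw [memProb]
  linarith

theorem alphaNeg_le_memProb [Nonempty A] : alphaNeg P ≤ memProb unifLaw (blockRank P τ) 0 := by
  have h1 : unifLaw.real (Set.Ico 0 (alphaNeg P)) = alphaNeg P := by
    rw [Measure.real, unifLaw, Measure.restrict_apply measurableSet_Ico,
      Set.inter_eq_left.2 (Set.Ico_subset_Ico_right (alphaNeg_le_one P)), Real.volume_Ico, sub_zero,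
      ENNReal.toReal_ofReal (alphaNeg_nonneg P)]
  have h2 := (measurePreserving_eval_infinitePi (fun _ : ℕ => unifLaw) 0).measureReal_preimage
    (s := Set.Ico 0 (alphaNeg P)) measurableSet_Ico.nullMeasurableSet
  rw [h1] at h2
  rw [← h2]
  refine measureReal_mono fun v hv => ?_
  have hv' : v 0 ∈ Set.Ico 0 (alphaNeg P) := hv
  have hlen : blockLen P τ v ≤ 1 := by
    refine Nat.sInf_le ⟨one_pos, fun j hj => Or.inl ?_⟩
    rw [Nat.lt_one_iff.1 hj]
    exact symbY_ne_none P hv'.1 hv'.2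
  change (Finset.range (blockLen P τ v)).sup (fun j => rank P τ (v j)) ≤ 0
  refine Finset.sup_le fun j hj => ?_
  have hj0 : j = 0 := by have := Finset.mem_range.1 hj; omega
  rw [hj0]
  refine rank_le ?_
  rw [memRate, if_pos rfl]
  exact hv'.2

end GoodBlockRule

/-! ### Coalescence times of a sequence of uniform variables -/

section Backward

variable {Ω : Type v} [MeasurableSpace Ω] {μ : Measure Ω} {U : ℤ → Ω → ℝ}

/-- Read backwards from time `n`, the sequence is a sequence of independent uniform variables. -/
theorem measurePreserving_backward (hU : IsIIDUniform μ U) (n : ℤ) :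
    MeasurePreserving (fun ω (k : ℕ) => U (n - k) ω) μ (iidLaw unifLaw) := by
  obtain ⟨hm, hi, hlaw⟩ := hU
  refine ⟨measurable_pi_lambda _ fun k => hm _, ?_⟩
  have hinj : Function.Injective fun k : ℕ => n - (k : ℤ) := fun a b hab => by
    simpa using hab
  rw [iIndepFun.map_fun_eq_infinitePi_map (fun k => hm _) (hi.precomp hinj)]
  simp only [hlaw]

theorem ae_mem_Ico : ∀ᵐ v ∂iidLaw unifLaw, ∀ i, v i ∈ Set.Ico (0 : ℝ) 1 :=
  ae_all_iff.2 fun i => (measurePreserving_eval_infinitePi (fun _ : ℕ => unifLaw)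
    i).quasiMeasurePreserving.ae (ae_restrict_mem measurableSet_Ico)

variable {A : Type u} [Encodable A] {P : TransitionKernel A} {τ : Set (PastString A)}

theorem tendsto_rateA (hULC : IsULC P τ) : Tendsto (rateA μ U P τ) atTop (𝓝 1) := by
  have h1 : Tendsto (fun k => 1 - (∫⁻ ω, ((goodTheta P τ (fun i => U i ω) 0).abs + 1) ∂μ).toReal *
      (1 - alphaUnif P τ k)) atTop (𝓝 1) := by
    simpa using (tendsto_const_nhds (x := (1 : ℝ))).sub
      (((tendsto_const_nhds (x := (1 : ℝ))).sub hULC).const_mul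
        (∫⁻ ω, ((goodTheta P τ (fun i => U i ω) 0).abs + 1) ∂μ).toReal)
  refine h1.congr' ?_
  filter_upwards [eventually_gt_atTop 0] with k hk
  rw [rateA, if_neg hk.ne']

variable [Nonempty A]

theorem lintegral_abs_goodTheta (hU : IsIIDUniform μ U) (hτ : IsContextTree τ) :
    ∫⁻ ω, ((goodTheta P τ (fun i => U i ω) 0).abs + 1) ∂μ =
      ∫⁻ v, blockLenE P τ v ∂iidLaw unifLaw := by
  rw [← (measurePreserving_backward hU 0).lintegral_comp (measurable_blockLenE hτ)]
  exact lintegral_congr fun ω => abs_goodTheta_add_one P τ fun i => U i ω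

theorem lintegral_blockLenE_ne_top [IsProbabilityMeasure μ] (hU : IsIIDUniform μ U)
    (hτ : IsContextTree τ) (hG : IsGood μ U P τ) : ∫⁻ v, blockLenE P τ v ∂iidLaw unifLaw ≠ ⊤ := by
  rw [← lintegral_abs_goodTheta hU hτ, lintegral_add_right _ measurable_const, lintegral_one,
    measure_univ]
  exact ENNReal.add_ne_top.2 ⟨hG, ENNReal.one_ne_top⟩

theorem rateA_le_memProb [IsProbabilityMeasure μ] (hU : IsIIDUniform μ U) (hτ : IsContextTree τ)
    (hG : IsGood μ U P τ) (m : ℕ) : rateA μ U P τ m ≤ memProb unifLaw (blockRank P τ) m := by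
  rw [rateA]
  split_ifs with hm
  · rw [hm]
    exact alphaNeg_le_memProb
  · have := one_sub_le_memProb hτ (lintegral_blockLenE_ne_top hU hτ hG) m
    rwa [memRate, if_neg hm, ← lintegral_abs_goodTheta hU hτ] at this

theorem memProb_le_one (M : (ℕ → ℝ) → ℕ) (m : ℕ) : memProb unifLaw M m ≤ 1 := measureReal_le_one

theorem memProb_pos (hP : WeaklyNonNull P) (m : ℕ) : 0 < memProb unifLaw (blockRank P τ) m :=
  lt_of_lt_of_le hP <| alphaNeg_le_memProb.trans <|
    measureReal_mono fun _ hv => le_trans hv (Nat.zero_le m)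

/-- The coalescence time is bounded by the total length of the blocks up to the first one that
closes the sequence. -/
theorem ae_abs_theta_add_one_le (hU : IsIIDUniform μ U) (hτ : IsContextTree τ)
    (hULC : IsULC P τ) (hE : ∫⁻ v, blockLenE P τ v ∂iidLaw unifLaw ≠ ⊤) :
    ∀ᵐ ω ∂μ, (theta (update P τ) (fun i => U i ω) 0 0).abs + 1 ≤
      totalLen (blockLen P τ) (blockRank P τ) fun k : ℕ => U (0 - k) ω := by
  have hrule := isBlockRule_blockLen hτ hE
  filter_upwards [(measurePreserving_backward hU 0).quasiMeasurePreserving.ae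
    hrule.ae_iterate_len_pos, (measurePreserving_backward hU 0).quasiMeasurePreserving.ae
    ae_mem_Ico] with ω hpos h01
  set v : ℕ → ℝ := fun k => U (0 - k) ω with hv
  by_cases hex : ∃ r, Closed (blockSeq (blockLen P τ) (blockRank P τ) v) r
  · obtain ⟨r, hr, hle⟩ := exists_closed_le_totalLen hex
    refine le_trans ?_ hle
    have h1 := le_theta hτ hULC (fun i => U i ω) 0 v hv h01 (fun k _ => hpos k) hr
    have h2 := theta_le (F := update P τ) (u := fun i => U i ω) 0 0
    set θ := theta (update P τ) (fun i => U i ω) 0 0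
    lift θ to ℝ using
      ⟨fun h => by rw [h] at h2; simp at h2,
        fun h => EReal.coe_ne_bot _ (le_bot_iff.1 (h ▸ h1))⟩ with x
    rw [EReal.coe_le_coe_iff] at h1 h2
    push_cast at h1 h2
    rw [EReal.abs_def, ← ENNReal.ofReal_one, ← ENNReal.ofReal_add (abs_nonneg x) zero_le_one,
      ← ENNReal.ofReal_natCast]
    refine ENNReal.ofReal_le_ofReal ?_
    rw [abs_of_nonpos h2]
    linarith
  · rw [totalLen_eq_top hpos hex]
    exact le_top

/-- If the blocks are almost surely closed, then the coupling from the past is feasible. -/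
theorem isFeasible_update (hU : IsIIDUniform μ U) (hτ : IsContextTree τ)
    (hULC : IsULC P τ) (hE : ∫⁻ v, blockLenE P τ v ∂iidLaw unifLaw ≠ ⊤)
    (hlim : Tendsto (openProb unifLaw (blockLen P τ) (blockRank P τ)) atTop (𝓝 0)) :
    (∀ᵐ ω ∂μ, theta (update P τ) (fun i => U i ω) 0 0 ≠ ⊥) ∧ IsFeasible μ U (update P τ) := by
  have hrule := isBlockRule_blockLen hτ hE
  have key : ∀ᵐ ω ∂μ, ∀ n : ℤ, theta (update P τ) (fun i => U i ω) n n ≠ ⊥ := by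
    refine ae_all_iff.2 fun n => ?_
    have hq := (measurePreserving_backward hU n).quasiMeasurePreserving
    filter_upwards [hq.ae hrule.ae_iterate_len_pos, hq.ae ae_mem_Ico,
      hq.ae (IsBlockRule.ae_exists_closed hlim)] with ω hpos h01 ⟨r, hr⟩
    have h1 := le_theta hτ hULC (fun i => U i ω) n _ rfl h01 (fun k _ => hpos k) hr
    exact ((EReal.bot_lt_coe _).trans_le h1).ne'
  refine ⟨key.mono fun ω h => h 0, fun m n _ => ?_⟩
  filter_upwards [key] with ω h
  exact theta_ne_bot_of_forall h

theorem measurable_totalLen {ρ : Measure ℝ} [IsProbabilityMeasure ρ] {T M : (ℕ → ℝ) → ℕ}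
    (h : IsBlockRule ρ T M) : Measurable (totalLen T M) :=
  Measurable.tsum fun k => ((measurable_of_countable fun n : ℕ => (n : ℝ≥0∞)).comp
    (h.measurable_len.comp (h.measurable_iterate k))).indicator (h.measurableSet_open k)

theorem measure_le_abs_theta_le (hU : IsIIDUniform μ U) (hτ : IsContextTree τ)
    (hULC : IsULC P τ) (hE : ∫⁻ v, blockLenE P τ v ∂iidLaw unifLaw ≠ ⊤) (n : ℕ) :
    μ {ω | (n : ℝ≥0∞) ≤ (theta (update P τ) (fun i => U i ω) 0 0).abs} ≤
      iidLaw unifLaw {v | ((n + 1 : ℕ) : ℝ≥0∞) ≤ totalLen (blockLen P τ) (blockRank P τ) v} := by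
  rw [← (measurePreserving_backward hU 0).measure_preimage (measurableSet_le measurable_const
    (measurable_totalLen (isBlockRule_blockLen hτ hE))).nullMeasurableSet]
  refine measure_mono_ae ?_
  filter_upwards [ae_abs_theta_add_one_le hU hτ hULC hE] with ω hω h
  have h' : (n : ℝ≥0∞) ≤ (theta (update P τ) (fun i => U i ω) 0 0).abs := h
  change ((n + 1 : ℕ) : ℝ≥0∞) ≤ _
  refine le_trans ?_ hω
  push_cast
  exact add_le_add_left h' 1

theorem tsum_measure_le_lintegral {α : Type*} [MeasurableSpace α] {ν : Measure α} {f : α → ℝ≥0∞}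
    (hf : Measurable f) : ∑' n : ℕ, ν {x | ((n + 1 : ℕ) : ℝ≥0∞) ≤ f x} ≤ ∫⁻ x, f x ∂ν := by
  have hm : ∀ n : ℕ, MeasurableSet {x | ((n + 1 : ℕ) : ℝ≥0∞) ≤ f x} := fun n =>
    measurableSet_le measurable_const hf
  have h1 : ∀ n : ℕ, ν {x | ((n + 1 : ℕ) : ℝ≥0∞) ≤ f x} =
      ∫⁻ x, {x | ((n + 1 : ℕ) : ℝ≥0∞) ≤ f x}.indicator 1 x ∂ν := fun n =>
    (lintegral_indicator_one (hm n)).symm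
  simp only [h1]
  rw [← lintegral_tsum fun n => (measurable_one.indicator (hm n)).aemeasurable]
  refine lintegral_mono fun x => ENNReal.tsum_le_of_sum_range_le fun n => ?_
  induction n with
  | zero => simp
  | succ n ih =>
    by_cases hn : ((n + 1 : ℕ) : ℝ≥0∞) ≤ f x
    · refine le_trans ?_ hn
      calc _ ≤ ∑ _i ∈ Finset.range (n + 1), (1 : ℝ≥0∞) :=
            Finset.sum_le_sum fun i _ => Set.indicator_le_self
              {x | ((i + 1 : ℕ) : ℝ≥0∞) ≤ f x} (1 : α → ℝ≥0∞) x
        _ = _ := by simp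
    · rw [Finset.sum_range_succ, Set.indicator_of_notMem (by exact hn), add_zero]
      exact ih

theorem hasSummableTail_theta (hU : IsIIDUniform μ U) (hτ : IsContextTree τ)
    (hULC : IsULC P τ) (hE : ∫⁻ v, blockLenE P τ v ∂iidLaw unifLaw ≠ ⊤)
    (hs : Summable (openProb unifLaw (blockLen P τ) (blockRank P τ))) :
    HasSummableTail μ fun ω => theta (update P τ) (fun i => U i ω) 0 0 := by
  have hrule := isBlockRule_blockLen hτ hE
  refine ne_top_of_le_ne_top ?_ ((ENNReal.tsum_le_tsum fun n =>
    measure_le_abs_theta_le hU hτ hULC hE n).trans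
      (tsum_measure_le_lintegral (measurable_totalLen hrule)))
  rw [hrule.lintegral_totalLen, lintegral_blockLen hτ hE]
  exact ENNReal.mul_ne_top (IsBlockRule.tsum_measure_open_ne_top hs) hE

/-- An exponential tail of `θ̄` gives an exponential moment of the length of the block. -/
theorem exists_lintegral_pow_ne_top (hU : IsIIDUniform μ U) (hτ : IsContextTree τ)
    (hE : ∫⁻ v, blockLenE P τ v ∂iidLaw unifLaw ≠ ⊤)
    (ht : HasExpTail μ fun ω => goodTheta P τ (fun i => U i ω) 0) :
    ∃ s : ℝ, 1 < s ∧ ∫⁻ v, ENNReal.ofReal s ^ blockLen P τ v ∂iidLaw unifLaw ≠ ⊤ := by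
  obtain ⟨D, d, hD, hd, hd1, htail⟩ := ht
  obtain ⟨s, hs1, hsd⟩ : ∃ s : ℝ, 1 < s ∧ s * d < 1 := by
    refine ⟨(1 + d⁻¹) / 2, ?_, ?_⟩
    · have := (one_lt_inv₀ hd).2 hd1
      linarith
    · have : d⁻¹ * d = 1 := inv_mul_cancel₀ hd.ne'
      nlinarith
  have hs0 : 0 < s := one_pos.trans hs1
  refine ⟨s, hs1, ?_⟩
  have hm : ∀ t, MeasurableSet {v | blockLen P τ v = t + 1} := fun t =>
    measurable_blockLen hτ (measurableSet_singleton (t + 1))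
  have hmass : ∀ t : ℕ, iidLaw unifLaw {v | blockLen P τ v = t + 1} ≤
      ENNReal.ofReal (D * d ^ t) := by
    intro t
    refine le_trans ?_ (htail t)
    rw [← (measurePreserving_backward hU 0).measure_preimage (hm t).nullMeasurableSet]
    refine measure_mono fun ω hω => ?_
    have h1 : blockLen P τ (fun k : ℕ => U (0 - k) ω) = t + 1 := hω
    have h2 := abs_goodTheta_add_one P τ fun i => U i ω
    rw [blockLenE, h1, if_neg t.succ_ne_zero, Nat.cast_add, Nat.cast_one] at h2
    exact ((ENNReal.add_left_inj ENNReal.one_ne_top).1 h2).ge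
  have hle : ∫⁻ v, ENNReal.ofReal s ^ blockLen P τ v ∂iidLaw unifLaw ≤
      ∑' t : ℕ, ENNReal.ofReal (D * s * (s * d) ^ t) := by
    have hdec : ∫⁻ v, ENNReal.ofReal s ^ blockLen P τ v ∂iidLaw unifLaw =
        ∫⁻ v, ∑' t : ℕ, {v | blockLen P τ v = t + 1}.indicator
          (fun _ => ENNReal.ofReal s ^ (t + 1)) v ∂iidLaw unifLaw := by
      refine lintegral_congr_ae ?_
      filter_upwards [ae_blockLen_pos hτ hE] with v hv
      obtain ⟨t, ht⟩ := Nat.exists_eq_succ_of_ne_zero hv.ne'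
      rw [tsum_eq_single t, Set.indicator_of_mem (by exact ht), ht]
      intro t' ht'
      refine Set.indicator_of_notMem (s := {v | blockLen P τ v = t' + 1}) (a := v) ?_ _
      intro h
      have h' : blockLen P τ v = t' + 1 := h
      omega
    rw [hdec, lintegral_tsum fun t => (measurable_const.indicator (hm t)).aemeasurable]
    refine ENNReal.tsum_le_tsum fun t => ?_
    rw [lintegral_indicator_const (hm t)]
    refine (mul_le_mul_right (hmass t) _).trans (le_of_eq ?_)
    rw [← ENNReal.ofReal_pow hs0.le, ← ENNReal.ofReal_mul (by positivity)]
    congr 1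
    rw [mul_pow]
    ring
  refine ne_top_of_le_ne_top ?_ hle
  exact ((summable_geometric_of_lt_one (by positivity) hsd).mul_left (D * s)).tsum_ofReal_ne_top

theorem exists_pow_div_le {r : ℝ} (hr : 0 < r) (hr1 : r < 1) (q : ℕ) :
    ∃ D d : ℝ, 0 < D ∧ 0 < d ∧ d < 1 ∧ ∀ n : ℕ, r ^ (n / (q + 1)) ≤ D * d ^ n := by
  set d := r ^ ((1 : ℝ) / (q + 1)) with hd
  have hq : (0 : ℝ) < q + 1 := by positivity
  have hd0 : 0 < d := Real.rpow_pos_of_pos hr _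
  have hd1 : d < 1 := Real.rpow_lt_one hr.le hr1 (by positivity)
  have hdr : d ^ (q + 1) = r := by
    rw [hd, ← Real.rpow_natCast, ← Real.rpow_mul hr.le]
    push_cast
    rw [one_div_mul_cancel hq.ne', Real.rpow_one]
  refine ⟨(d ^ q)⁻¹, d, inv_pos.2 (pow_pos hd0 q), hd0, hd1, fun n => ?_⟩
  rw [← hdr, ← pow_mul, inv_mul_eq_div, le_div_iff₀ (pow_pos hd0 q), ← pow_add]
  refine pow_le_pow_of_le_one hd0.le hd1.le ?_
  have h1 := Nat.div_add_mod n (q + 1)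
  have h2 := Nat.mod_lt n (by omega : 0 < q + 1)
  omega

theorem hasExpTail_theta (hU : IsIIDUniform μ U) (hτ : IsContextTree τ)
    (hULC : IsULC P τ) (hE : ∫⁻ v, blockLenE P τ v ∂iidLaw unifLaw ≠ ⊤)
    (ht : HasExpTail μ fun ω => goodTheta P τ (fun i => U i ω) 0) {q : ℝ} (hq0 : 0 < q)
    (hq1 : q < 1) (hq : ∀ n, openProb unifLaw (blockLen P τ) (blockRank P τ) n ≤ q ^ n) :
    HasExpTail μ fun ω => theta (update P τ) (fun i => U i ω) 0 0 := by
  have hrule := isBlockRule_blockLen hτ hE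
  obtain ⟨s, hs1, hs⟩ := exists_lintegral_pow_ne_top hU hτ hE ht
  have hs0 : 0 < s := one_pos.trans hs1
  set S := ENNReal.ofReal s with hS
  set I := ∫⁻ v, S ^ blockLen P τ v ∂iidLaw unifLaw with hI
  have hS1 : 1 ≤ S := by
    rw [hS, ← ENNReal.ofReal_one]
    exact ENNReal.ofReal_le_ofReal hs1.le
  -- The number of blocks is cut at a level proportional to `n`, so small that the total length of
  -- these blocks is unlikely to reach `n`.
  obtain ⟨l, hl⟩ : ∃ l : ℕ, I ≤ S ^ l := by
    obtain ⟨l, hl⟩ := pow_unbounded_of_one_lt I.toReal hs1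
    refine ⟨l, ?_⟩
    rw [← ENNReal.ofReal_toReal hs, hS, ← ENNReal.ofReal_pow hs0.le]
    exact ENNReal.ofReal_le_ofReal hl.le
  set r := max q s⁻¹ with hr
  have hr0 : 0 < r := lt_max_of_lt_left hq0
  have hr1 : r < 1 := max_lt hq1 (inv_lt_one_of_one_lt₀ hs1)
  obtain ⟨D, d, hD, hd, hd1, hdec⟩ := exists_pow_div_le hr0 hr1 l
  refine ⟨2 * D, d, by positivity, hd, hd1, fun n => ?_⟩
  set m := n / (l + 1) with hm
  have hmn : l * m + m ≤ n + 1 := by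
    have := Nat.div_mul_le_self n (l + 1)
    rw [← hm] at this
    linarith [this, (by ring : m * (l + 1) = l * m + m)]
  have h1 : ENNReal.ofReal (openProb unifLaw (blockLen P τ) (blockRank P τ) m) ≤
      ENNReal.ofReal (r ^ m) :=
    ENNReal.ofReal_le_ofReal ((hq m).trans (pow_le_pow_left₀ hq0.le (le_max_left _ _) m))
  have h2 : I ^ m / S ^ (n + 1) ≤ ENNReal.ofReal (r ^ m) := by
    refine le_trans ?_ (ENNReal.ofReal_le_ofReal
      (pow_le_pow_left₀ (inv_pos.2 hs0).le (le_max_right q s⁻¹) m))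
    rw [ENNReal.ofReal_pow (inv_pos.2 hs0).le, ENNReal.ofReal_inv_of_pos hs0]
    refine ENNReal.div_le_of_le_mul ?_
    calc I ^ m ≤ (S ^ l) ^ m := pow_le_pow_left₀ zero_le hl m
      _ = S⁻¹ ^ m * S ^ (l * m + m) := by
        rw [pow_add, mul_left_comm, ← mul_pow,
          ENNReal.inv_mul_cancel (one_pos.trans_le hS1).ne' ENNReal.ofReal_ne_top, one_pow,
          mul_one, pow_mul]
      _ ≤ S⁻¹ ^ m * S ^ (n + 1) := mul_le_mul_right (pow_le_pow_right₀ hS1 hmn) _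
  calc _ ≤ _ := measure_le_abs_theta_le hU hτ hULC hE n
    _ ≤ _ := hrule.measure_le_totalLen (n + 1) m hS1 ENNReal.ofReal_ne_top
    _ ≤ ENNReal.ofReal (r ^ m) + ENNReal.ofReal (r ^ m) := add_le_add h1 h2
    _ = ENNReal.ofReal (2 * r ^ m) := by
      rw [← ENNReal.ofReal_add (pow_pos hr0 m).le (pow_pos hr0 m).le, two_mul]
    _ ≤ ENNReal.ofReal (2 * D * d ^ n) := ENNReal.ofReal_le_ofReal (by linarith [hdec n])

end Backward

/-! ### The root tree -/

section Root

variable {A : Type u}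

theorem isContextTree_rootTree : IsContextTree (rootTree A) := fun _ =>
  ⟨Sum.inl [], ⟨rfl, rfl⟩, fun _ h => h.1⟩

theorem context_rootTree (x : Stream' A) : context (rootTree A) x = Sum.inl [] :=
  (context_spec isContextTree_rootTree x).1

variable (P : TransitionKernel A)

theorem abs_goodTheta_rootTree [Encodable A] (u : ℤ → ℝ) :
    (goodTheta P (rootTree A) u 0).abs = 0 := by
  have hgood : GoodDepth P (rootTree A) (fun k : ℕ => u (0 - k)) 1 := fun j _ => by
    refine Or.inr (iSup_le fun a => ?_)
    have h := context_rootTree fun k : ℕ => (symbY P (u (0 - (j + 1 + k : ℕ)))).getD (a k)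
    exact le_of_eq_of_le (congrArg PastString.len h) zero_le
  have hlen : blockLen P (rootTree A) (fun k : ℕ => u (0 - k)) = 1 := by
    refine le_antisymm (Nat.sInf_le ⟨one_pos, hgood⟩) ?_
    exact (Nat.sInf_mem (s := {t | 0 < t ∧ GoodDepth P (rootTree A) (fun k : ℕ => u (0 - k)) t})
      ⟨1, one_pos, hgood⟩).1
  have h := abs_goodTheta_add_one P (rootTree A) u
  rw [blockLenE, hlen, if_neg one_ne_zero, Nat.cast_one] at h
  simpa using h

theorem omegaRate_zero : omegaRate P 0 = alphaNeg P := by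
  have h : ∀ b : List.Vector A 0, ∑' a, lowerProb P b.toList a = alphaNeg P := fun b => by
    rw [List.Vector.eq_nil b]
    rfl
  have : Nonempty (List.Vector A 0) := ⟨List.Vector.nil⟩
  simp only [omegaRate, h]
  exact ciInf_const

variable [Nonempty A]

theorem alphaUnif_rootTree (k : ℕ) : alphaUnif P (rootTree A) k = omegaRate P k := by
  have hctx : alphaCtx P [] k = omegaRate P k := by simp [alphaCtx, omegaRate]
  refine IsLeast.csInf_eq ⟨Or.inr ⟨[], rfl, hctx.symm⟩, ?_⟩
  rintro _ (rfl | ⟨v, hv, rfl⟩)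
  · rw [← hctx]
    exact (alphaCtx_le P [] (List.Vector.replicate k (Classical.arbitrary A))).trans
      (tsum_lowerProb_le_one P _)
  · have hv' : v = [] := Sum.inl_injective hv
    rw [hv', hctx]

end Root

end CFTP

end


open CFTP
theorem corollary3 {A : Type*} [Encodable A] [Nonempty A]
    {Ω : Type*} [MeasurableSpace Ω] (μ : Measure Ω) [IsProbabilityMeasure μ]
    (U : ℤ → Ω → ℝ) (hU : IsIIDUniform μ U)
    (P : TransitionKernel A) (hP : WeaklyNonNull P) :
    (∀ τ : Set (PastString A), IsSkeleton τ → IsULC P τ → IsGood μ U P τ →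
      ∃ F : Stream' A → ℝ → A, IsUpdateFunction P F ∧
        (Tendsto (fun n : ℕ => ∑ k ∈ Finset.Icc 1 n, ∏ j ∈ Finset.range k, rateA μ U P τ j)
            atTop atTop →
          (∀ᵐ ω ∂μ, theta F (fun i => U i ω) 0 0 ≠ ⊥) ∧ IsFeasible μ U F) ∧
        (Summable (fun k : ℕ => 1 - rateA μ U P τ k) →
          HasSummableTail μ (fun ω => theta F (fun i => U i ω) 0 0) ∧ IsFeasible μ U F) ∧
        (HasExpTail μ (fun ω => goodTheta P τ (fun i => U i ω) 0) →
          DecaysExp (fun k : ℕ => 1 - rateA μ U P τ k) →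
          HasExpTail μ (fun ω => theta F (fun i => U i ω) 0 0) ∧ IsFeasible μ U F)) ∧
    (IsSkeleton (rootTree A) ∧ IsGood μ U P (rootTree A) ∧
      (IsULC P (rootTree A) ↔ IsContinuousKernel P) ∧
      ∀ k : ℕ, rateA μ U P (rootTree A) k = omegaRate P k) := by
  constructor
  · rintro τ ⟨hτ, -⟩ hULC hG
    have hE := lintegral_blockLenE_ne_top hU hτ hG
    have hren := (isBlockRule_blockLen hτ hE).isRenewal
    have hp := memProb_pos (τ := τ) hP
    have hp1 := memProb_le_one (blockRank P τ)
    have hu0 := openProb_nonneg (ρ := unifLaw) (blockLen P τ) (blockRank P τ)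
    have hrate := rateA_le_memProb hU hτ hG
    refine ⟨update P τ, isUpdateFunction_update P hτ hULC, fun hsum => ?_, fun hsum => ?_,
      fun hexp hdec => ?_⟩
    · refine isFeasible_update hU hτ hULC hE (hren.tendsto_zero hp
        (IsBlockRule.antitone_openProb _ _) hu0 ?_ hsum)
      filter_upwards [(tendsto_rateA (μ := μ) (U := U) hULC).eventually_const_lt zero_lt_one] with j hj
      rw [abs_of_pos hj]
      exact hrate j
    · have hs := hren.summable hp hp1 hu0 (Summable.of_nonneg_of_le
        (fun j => sub_nonneg.2 (hp1 j)) (fun j => sub_le_sub_left (hrate j) 1) hsum)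
      exact ⟨hasSummableTail_theta hU hτ hULC hE hs,
        (isFeasible_update hU hτ hULC hE hs.tendsto_atTop_zero).2⟩
    · obtain ⟨D, d, -, hd, hd1, hD⟩ := hdec
      obtain ⟨q, hq0, hq1, hq⟩ := hren.exists_le_pow hp hp1 hd hd1 fun j =>
        (sub_le_sub_left (hrate j) 1).trans (hD j)
      exact ⟨hasExpTail_theta hU hτ hULC hE hexp hq0 hq1 hq, (isFeasible_update hU hτ hULC hE
        (squeeze_zero hu0 hq (tendsto_pow_atTop_nhds_zero_of_lt_one hq0.le hq1))).2⟩
  · refine ⟨⟨isContextTree_rootTree, Or.inl rfl⟩, ?_, ?_, fun k => ?_⟩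
    · simp [IsGood, abs_goodTheta_rootTree]
    · rw [IsULC, IsContinuousKernel, funext (alphaUnif_rootTree P)]
    · rw [rateA]
      split_ifs with hk
      · rw [hk, omegaRate_zero]
      · simp [abs_goodTheta_rootTree, alphaUnif_rootTree]
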